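/- Let $n\in\mathbb{N}$ and write $X=(x,z)$, $x\in\mathbb{R}^n$, $z\in\mathbb{R}$, for the points of $\mathbb{R}^{n+1}=\mathbb{R}^n\times\mathbb{R}$; let $\mathrm{pr}_H(x,z)=x$ and let $o$ be the origin of $\mathbb{R}^n$. Let $q>0$, let $\Psi:\mathbb{R}^{n+1}\to[0,\infty)$ be continuous, and let $\mu$ be the measure on $\mathbb{R}^{n+1}$ with density $d\mu(X)=\Psi(X)\,|x|^{q-n}\,dx\,dz$. For a non-empty compact convex set $L\subset\mathbb{R}^{n+1}$ and a boundary point $X\in\partial L$, let $N_L(X)$ be the set of unit vectors $\nu\in\mathbb{S}^n$ such that $Y\cdot\nu\le X\cdot\nu$ for all $Y\in L$, and for $B\subset\mathbb{S}^n$ let $N_L^{-1}(B)=\{X\in\partial L: N_L(X)\cap B\neq\emptyset\}$. If $L$ has non-empty interior, its weighted surface area measure is the Borel measure on $\mathbb{S}^n$ given by $$S_{\mu,L}(B)=\int_{N_L^{-1}(B)}\Psi(X)\,|x|^{q-n}\,d\mathcal{H}^n(X),\qquad B\subset\mathbb{S}^n\text{ Borel},$$ where $\mathcal{H}^n$ is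 the $n$-dimensional Hausdorff measure; if $L$ has empty interior, $S_{\mu,L}$ is the smallest Borel measure that is at least the right-hand side on every Borel set $B$. Let $(K_m)_{m\in\mathbb{N}}$ be a sequence of non-empty compact convex subsets of $\mathbb{R}^{n+1}$ that converges in the Hausdorff metric to a compact convex set $K\subset\mathbb{R}^{n+1}$ with non-empty interior. If $q<n$, suppose moreover that $$o\in \mathrm{pr}_H\Big(\mathrm{int}\,K\cap\bigcap_{m\in\mathbb{N}}\mathrm{int}\,K_m\Big).$$ Then: 1. $\mu(K)<\infty$ and $\mu(K_m)\to\mu(K)$ as $m\to\infty$. 2. $S_{\mu,K}$ is finite, $S_{\mu,K_m}$ is finite for all sufficiently large $m$, and $S_{\mu,K_m}$ converges weakly to $S_{\mu,K}$, that is, for every continuous $f:\mathbb{S}^n\to\mathbb{R}$, $$\int_{\mathbb{S}^n}f\,dS_{\mu,K_m}\to\int_{\mathbb{S}^n}f\,dS_{\mu,K}.$$ -/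

import Mathlib

open MeasureTheory Set Filter Topology
open scoped ENNReal RealInnerProductSpace

noncomputable section

namespace WeightedBM

/-- `ℝⁿ` with the Euclidean norm; a point `X = (x, z)` of `ℝⁿ⁺¹ = ℝⁿ × ℝ` is a point of `E (n + 1)`,
the last coordinate being `z`. -/
abbrev E (n : ℕ) : Type := EuclideanSpace ℝ (Fin n)

/-- The unit sphere of `ℝᵈ`. -/
abbrev S (d : ℕ) : Type := Metric.sphere (0 : E d) 1

/-- The orthogonal projection `(x, z) ↦ x` of `ℝⁿ⁺¹` onto the hyperplane `ℝⁿ` of the first `n`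
coordinates. -/
def prH {n : ℕ} (X : E (n + 1)) : E n := WithLp.toLp 2 (fun i => X i.castSucc)

/-- The density `X = (x, z) ↦ Ψ(X) |x|^(q - n)`, with values in `[0, ∞]`
(for `q < n` the factor `|x|^(q - n)` is `∞` where `x = 0`). -/
def density {n : ℕ} (q : ℝ) (Ψ : E (n + 1) → ℝ) (X : E (n + 1)) : ℝ≥0∞ :=
  ENNReal.ofReal (Ψ X) * ‖prH X‖ₑ ^ (q - n)

/-- The measure `dμ = Ψ(X) |x|^(q - n) dx dz` on `ℝⁿ⁺¹`. -/
def weightedMeasure {n : ℕ} (q : ℝ) (Ψ : E (n + 1) → ℝ) : Measure (E (n + 1)) :=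
  (volume : Measure (E (n + 1))).withDensity (density q Ψ)

/-- The unit normal cone `N_K(X)`, i.e. the value at `X` of the generalized Gauss map of `K`: all
unit vectors `ν` such that `K` has at `X` a supporting hyperplane with outer unit normal `ν`. -/
def gaussMap {d : ℕ} (K : ConvexBody (E d)) (X : E d) : Set (S d) :=
  {ν | ∀ Y ∈ K, ⟪Y, (ν : E d)⟫ ≤ ⟪X, (ν : E d)⟫}

/-- The inverse image `N_K⁻¹(B)`: all boundary points of `K` with an outer unit normal in `B`. -/
def gaussPreimage {d : ℕ} (K : ConvexBody (E d)) (B : Set (S d)) : Set (E d) :=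
  {X | X ∈ frontier (K : Set (E d)) ∧ (gaussMap K X ∩ B).Nonempty}

/-- The set function `B ↦ ∫_{N_K⁻¹(B)} w dℋⁿ`, where `ℋⁿ` is the `n`-dimensional Hausdorff measure
in the normalization that agrees with Lebesgue measure on `ℝⁿ`. -/
def weightedSurfaceArea {n : ℕ} (w : E (n + 1) → ℝ≥0∞) (K : ConvexBody (E (n + 1)))
    (B : Set (S (n + 1))) : ℝ≥0∞ :=
  ∫⁻ X in gaussPreimage K B, w X ∂(μHE[n] : Measure (E (n + 1)))

/-- The weighted surface area measure of `K`, as a Borel measure on the unit sphere: the smallest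
measure whose value on every Borel set `B` is at least `∫_{N_K⁻¹(B)} w dℋⁿ`. Whenever this set
function is countably additive on Borel sets (for `K` with nonempty interior it is, since `ℋⁿ`-almost
every boundary point has only one outer unit normal), it is equal to this measure: see
`weightedSurfaceAreaMeasure_eq`. For `K` contained in a hyperplane, where both sides of `K` count,
it is the usual convention. -/
def weightedSurfaceAreaMeasure {n : ℕ} (w : E (n + 1) → ℝ≥0∞) (K : ConvexBody (E (n + 1))) :
    Measure (S (n + 1)) :=
  sInf {σ | ∀ B, MeasurableSet B → weightedSurfaceArea w K B ≤ σ B}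

theorem weightedSurfaceAreaMeasure_eq {n : ℕ} (w : E (n + 1) → ℝ≥0∞) (K : ConvexBody (E (n + 1)))
    (σ : Measure (S (n + 1))) (h : ∀ B, MeasurableSet B → σ B = weightedSurfaceArea w K B) :
    weightedSurfaceAreaMeasure w K = σ := by
  refine le_antisymm (sInf_le fun B hB => (h B hB).ge) (le_sInf fun τ hτ => ?_)
  exact Measure.le_iff.2 fun B hB => (h B hB).le.trans (hτ B hB)

theorem weightedSurfaceAreaMeasure_apply {n : ℕ} (w : E (n + 1) → ℝ≥0∞)
    (K : ConvexBody (E (n + 1)))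
    (h : ∀ B : ℕ → Set (S (n + 1)), (∀ i, MeasurableSet (B i)) → Pairwise (Function.onFun Disjoint B) →
      weightedSurfaceArea w K (⋃ i, B i) = ∑' i, weightedSurfaceArea w K (B i))
    {B : Set (S (n + 1))} (hB : MeasurableSet B) :
    weightedSurfaceAreaMeasure w K B =
      ∫⁻ X in gaussPreimage K B, w X ∂(μHE[n] : Measure (E (n + 1))) := by
  have h0 : weightedSurfaceArea w K ∅ = 0 := by simp [weightedSurfaceArea, gaussPreimage]
  rw [weightedSurfaceAreaMeasure_eq w K
    (Measure.ofMeasurable (fun B _ => weightedSurfaceArea w K B) h0 (fun B hB hd => h B hB hd))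
    (fun B hB => Measure.ofMeasurable_apply B hB), Measure.ofMeasurable_apply B hB,
    weightedSurfaceArea]

end WeightedBM

end

noncomputable section

namespace WeightedBM

open scoped NNReal

/-! Part 1 is dominated convergence. The density is locally integrable because `q > 0`, and the
indicators of the bodies converge off the boundary of the limit, which is Lebesgue null.

For part 2, a convex body with interior points has a unique outer normal at `ℋⁿ`-almost every
boundary point: its gauge is Lipschitz, and where the gauge is differentiable its derivative
determines the normal. Hence the weighted surface area measure is the image of the weighted boundary
measure under any choice of normal (`weightedSurfaceAreaMeasure_eq_map`), and it suffices to study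
integrals of `g (X, normal X)` over the boundaries.

Two boundaries are compared by a single map. If `L` contains a ball of radius `r` about `c` and `s =
dist M L / r`, then `M` lies in the dilate of `L` by `1 + s` about `c`. Dilation followed by metric
projection onto `M` is `(1 + s)`-Lipschitz and carries `∂L` onto `∂M`; for `M` near `L` it is near
the identity. An integral over `∂M` is therefore at most `(1 + s)ⁿ` times that of the pulled-back
integrand over `∂L`. Normals converge at points where the limit normal is unique, so reverse Fatou
gives upper semicontinuity of these integrals. Exchanging the two bodies gives convergence of the
total areas, and upper semicontinuity for both `g` and `M - g` then gives convergence for continuous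
`g`.

If `q ≥ n` the density is continuous and this suffices. If `q < n` it is singular on the axis `x =
0`, which passes through an interior point `c`. Near the axis the boundary consists of two radial
charts over small balls of `ℝⁿ`, with Lipschitz constants uniform in the body. Truncating the
singularity thus costs an error that is small uniformly in `m`. -/

/-! ### Hausdorff measure under Lipschitz maps, and a reverse Fatou lemma -/

theorem euclideanHausdorffMeasure_image_le {X Y : Type*} [MetricSpace X] [MeasurableSpace X]
    [BorelSpace X] [MetricSpace Y] [MeasurableSpace Y] [BorelSpace Y] {C : ℝ≥0} {Q : X → Y}
    {s : Set X} (hQ : LipschitzOnWith C Q s) (d : ℕ) :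
    (μHE[d] : Measure Y) (Q '' s) ≤ (C : ℝ≥0∞) ^ d * (μHE[d] : Measure X) s := by
  have h := hQ.hausdorffMeasure_image_le (d := (d : ℝ)) (by positivity)
  simp only [Measure.euclideanHausdorffMeasure_def, Measure.smul_apply, ENNReal.smul_def,
    smul_eq_mul]
  rw [ENNReal.rpow_natCast] at h
  calc _ ≤ _ * ((C : ℝ≥0∞) ^ d * (μH[(d : ℝ)] : Measure X) s) := by gcongr
    _ = _ := by ring

/-- Injectivity is not needed, since `Q '' s ∩ A = Q '' (s ∩ Q ⁻¹' A)`: overlaps only make the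
pushforward larger. -/
theorem restrict_image_le_smul_map {d : ℕ} {X Y : Type*} [MetricSpace X] [MeasurableSpace X]
    [BorelSpace X] [MetricSpace Y] [MeasurableSpace Y] [BorelSpace Y] {C : ℝ≥0} {Q : X → Y}
    {s : Set X} (hs : MeasurableSet s) (hQ : LipschitzOnWith C Q s)
    (hm : AEMeasurable Q ((μHE[d] : Measure X).restrict s)) :
    (μHE[d] : Measure Y).restrict (Q '' s) ≤
      (C : ℝ≥0∞) ^ d • ((μHE[d] : Measure X).restrict s).map Q := by
  refine Measure.le_iff.2 fun A hA => ?_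
  rw [Measure.restrict_apply hA, Measure.smul_apply, Measure.map_apply_of_aemeasurable hm hA,
    Measure.restrict_apply' hs, smul_eq_mul, inter_comm, ← image_inter_preimage, inter_comm s]
  exact euclideanHausdorffMeasure_image_le (hQ.mono inter_subset_right) d

theorem setLIntegral_image_le {X Y : Type*} [MetricSpace X] [MeasurableSpace X]
    [BorelSpace X] [MetricSpace Y] [MeasurableSpace Y] [BorelSpace Y] [SecondCountableTopology Y]
    {C : ℝ≥0} {Q : X → Y}
    {s : Set X} {d : ℕ} (hs : MeasurableSet s) (hQ : LipschitzOnWith C Q s) (f : Y → ℝ≥0∞) :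
    ∫⁻ y in Q '' s, f y ∂(μHE[d] : Measure Y) ≤
      (C : ℝ≥0∞) ^ d * ∫⁻ x in s, f (Q x) ∂(μHE[d] : Measure X) := by
  have hm : AEMeasurable Q ((μHE[d] : Measure X).restrict s) := hQ.continuousOn.aemeasurable hs
  calc _ ≤ ∫⁻ y, f y ∂((C : ℝ≥0∞) ^ d • ((μHE[d] : Measure X).restrict s).map Q) :=
        lintegral_mono' (restrict_image_le_smul_map hs hQ hm) le_rfl
    _ ≤ _ := by
      rw [lintegral_smul_measure, smul_eq_mul]
      gcongr
      exact lintegral_map_le _ _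

theorem limsup_lintegral_le_of_ae_tendsto {α : Type*} [MeasurableSpace α] {μ : Measure α}
    [IsFiniteMeasure μ] {h : ℕ → α → ℝ≥0∞} {h₀ : α → ℝ≥0∞} {M : ℝ≥0∞} (hM : M ≠ ∞)
    (hb : ∀ m x, h m x ≤ M) (ht : ∀ᵐ x ∂μ, Tendsto (fun m => h m x) atTop (𝓝 (h₀ x))) :
    limsup (fun m => ∫⁻ x, h m x ∂μ) atTop ≤ ∫⁻ x, h₀ x ∂μ := by
  -- The `h m` need not be measurable (later they involve a chosen normal composed with a
  -- projection). Measurable minorants with the same lower integral replace them.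
  choose g hgm hgle hgeq using fun m => exists_measurable_le_lintegral_eq μ (h m)
  simp only [hgeq]
  refine (limsup_lintegral_le (fun _ => M) hgm
    (fun m => ae_of_all _ fun x => (hgle m x).trans (hb m x)) ?_).trans (lintegral_mono_ae ?_)
  · simpa using ENNReal.mul_ne_top hM (measure_ne_top μ univ)
  · filter_upwards [ht] with x hx
    rw [← hx.limsup_eq]
    exact limsup_le_limsup (Eventually.of_forall fun m => hgle m x)

/-! ### Metric projection onto a convex body -/

section Projection

variable {d : ℕ}

theorem exists_projection (K : ConvexBody (E d)) (u : E d) :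
    ∃ v ∈ K, ∀ w ∈ K, ⟪u - v, w - v⟫ ≤ 0 := by
  obtain ⟨v, hv, h⟩ := exists_norm_eq_iInf_of_complete_convex K.nonempty
    K.isCompact.isComplete K.convex u
  exact ⟨v, hv, (norm_eq_iInf_iff_real_inner_le_zero K.convex hv).1 h⟩

/-- The metric projection onto a convex body. -/
def proj (K : ConvexBody (E d)) (u : E d) : E d := (exists_projection K u).choose

theorem proj_mem (K : ConvexBody (E d)) (u : E d) : proj K u ∈ K :=
  (exists_projection K u).choose_spec.1

theorem inner_proj_le (K : ConvexBody (E d)) (u : E d) {w : E d} (hw : w ∈ K) :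
    ⟪u - proj K u, w - proj K u⟫ ≤ 0 :=
  (exists_projection K u).choose_spec.2 w hw

theorem eq_proj (K : ConvexBody (E d)) {u v : E d} (hv : v ∈ K)
    (h : ∀ w ∈ K, ⟪u - v, w - v⟫ ≤ 0) : proj K u = v := by
  have h1 := h _ (proj_mem K u)
  have h2 := inner_proj_le K u hv
  have h3 : ⟪proj K u - v, proj K u - v⟫ = ⟪u - v, proj K u - v⟫ + ⟪u - proj K u, v - proj K u⟫ := by
    simp only [inner_sub_left, inner_sub_right, real_inner_comm]; ring
  have : ⟪proj K u - v, proj K u - v⟫ = 0 := le_antisymm (by linarith) real_inner_self_nonneg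
  exact sub_eq_zero.1 (inner_self_eq_zero.1 this)

theorem lipschitzWith_proj (K : ConvexBody (E d)) : LipschitzWith 1 (proj K) := by
  refine LipschitzWith.of_dist_le_mul fun u v => ?_
  rw [NNReal.coe_one, one_mul, dist_eq_norm, dist_eq_norm]
  have h1 := inner_proj_le K u (proj_mem K v)
  have h2 := inner_proj_le K v (proj_mem K u)
  have h3 : ⟪proj K u - proj K v, proj K u - proj K v⟫ = ⟪u - v, proj K u - proj K v⟫
      + ⟪u - proj K u, proj K v - proj K u⟫ + ⟪v - proj K v, proj K u - proj K v⟫ := by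
    simp only [inner_sub_left, inner_sub_right, real_inner_comm]; ring
  have h4 := real_inner_le_norm (u - v) (proj K u - proj K v)
  rw [real_inner_self_eq_norm_sq] at h3
  rcases (norm_nonneg (proj K u - proj K v)).eq_or_lt with h | h
  · rw [← h]; positivity
  · nlinarith

theorem dist_proj_le (K : ConvexBody (E d)) (u : E d) {w : E d} (hw : w ∈ K) :
    dist u (proj K u) ≤ dist u w := by
  have h1 := inner_proj_le K u hw
  rw [dist_eq_norm, dist_eq_norm]
  have h3 : ⟪u - w, u - w⟫ = ⟪u - proj K u, u - proj K u⟫ - 2 * ⟪u - proj K u, w - proj K u⟫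
      + ⟪w - proj K u, w - proj K u⟫ := by
    simp only [inner_sub_left, inner_sub_right, real_inner_comm]; ring
  have h4 : 0 ≤ ⟪w - proj K u, w - proj K u⟫ := real_inner_self_nonneg
  rw [real_inner_self_eq_norm_sq, real_inner_self_eq_norm_sq] at h3
  exact abs_le_of_sq_le_sq' (by linarith) (norm_nonneg _) |>.2

theorem dist_proj_le_dist (K L : ConvexBody (E d)) {u : E d} (hu : u ∈ L) :
    dist u (proj K u) ≤ dist K L := by
  have hne : Metric.hausdorffEDist (L : Set (E d)) K ≠ ⊤ := ConvexBody.hausdorffEDist_ne_top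
  refine le_of_forall_pos_le_add fun ε hε => ?_
  obtain ⟨w, hw, h⟩ := Metric.exists_dist_lt_of_hausdorffDist_lt (s := (L : Set (E d)))
    (t := (K : Set (E d))) (r := dist K L + ε) hu
    (by rw [ConvexBody.hausdorffDist_coe, dist_comm]; linarith) hne
  exact (dist_proj_le K u hw).trans h.le

end Projection

/-! ### The gauge of a body about an interior point -/

section Gauge

variable {d : ℕ}

/-- The gauge function of the translate `K - c`. -/
def gaugeAt (K : ConvexBody (E d)) (c v : E d) : ℝ := gauge ((fun x => c + x) ⁻¹' (K : Set (E d))) v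

variable {K : ConvexBody (E d)} {c : E d} {r R : ℝ}

theorem convex_translate (K : ConvexBody (E d)) (c : E d) :
    Convex ℝ ((fun x => c + x) ⁻¹' (K : Set (E d))) := K.convex.translate_preimage_right c

theorem ball_subset_translate (h : Metric.ball c r ⊆ (K : Set (E d))) :
    Metric.ball 0 r ⊆ (fun x => c + x) ⁻¹' (K : Set (E d)) := fun x hx => by
  refine h ?_
  simpa [dist_eq_norm] using hx

theorem translate_mem_nhds (hr : 0 < r) (h : Metric.ball c r ⊆ (K : Set (E d))) :
    (fun x => c + x) ⁻¹' (K : Set (E d)) ∈ 𝓝 0 :=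
  mem_of_superset (Metric.ball_mem_nhds 0 hr) (ball_subset_translate h)

theorem lipschitzWith_gaugeAt {r : ℝ≥0} (hr : 0 < r)
    (h : Metric.ball c r ⊆ (K : Set (E d))) : LipschitzWith r⁻¹ (gaugeAt K c) :=
  (convex_translate K c).lipschitzWith_gauge hr (ball_subset_translate h)

theorem gaugeAt_mul_le (h : Metric.ball c r ⊆ (K : Set (E d))) (v : E d) :
    r * gaugeAt K c v ≤ ‖v‖ := mul_gauge_le_norm (ball_subset_translate h)

theorem norm_le_mul_gaugeAt (hr : 0 < r) (h : Metric.ball c r ⊆ (K : Set (E d))) (hR : 0 < R)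
    (h' : (K : Set (E d)) ⊆ Metric.closedBall c R) (v : E d) : ‖v‖ ≤ R * gaugeAt K c v := by
  have := le_gauge_of_subset_closedBall (s := (fun x => c + x) ⁻¹' (K : Set (E d))) (r := R) (x := v)
    (absorbent_nhds_zero (translate_mem_nhds hr h)) hR.le
    (fun x hx => by simpa [dist_eq_norm] using h' hx)
  rwa [div_le_iff₀' hR] at this

theorem gaugeAt_smul {t : ℝ} (ht : 0 ≤ t) (v : E d) : gaugeAt K c (t • v) = t * gaugeAt K c v :=
  gauge_smul_of_nonneg ht v

theorem mem_frontier_iff_gaugeAt (hr : 0 < r) (h : Metric.ball c r ⊆ (K : Set (E d))) {v : E d} :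
    c + v ∈ frontier (K : Set (E d)) ↔ gaugeAt K c v = 1 := by
  rw [gaugeAt, gauge_eq_one_iff_mem_frontier (convex_translate K c) (translate_mem_nhds hr h)]
  have := (Homeomorph.addLeft c).preimage_frontier (K : Set (E d))
  simp only [Homeomorph.coe_addLeft] at this
  rw [← this]; rfl

theorem mem_iff_gaugeAt (hr : 0 < r) (h : Metric.ball c r ⊆ (K : Set (E d))) {v : E d} :
    c + v ∈ K ↔ gaugeAt K c v ≤ 1 := by
  rw [gaugeAt, gauge_le_one_iff_mem_closure (convex_translate K c) (translate_mem_nhds hr h),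
    IsClosed.closure_eq (K.isClosed.preimage (by fun_prop))]
  rfl

theorem gaugeAt_pos (hr : 0 < r) (h : Metric.ball c r ⊆ (K : Set (E d))) {v : E d} (hv : v ≠ 0) :
    0 < gaugeAt K c v := by
  obtain ⟨R, hR, h'⟩ := K.isBounded.subset_closedBall_lt 0 c
  have := norm_le_mul_gaugeAt hr h hR h' v
  have := norm_pos_iff.2 hv
  exact pos_of_mul_pos_right (by linarith) hR.le

/-- The point `c + (r / 2) ν` still lies in `K`, on the inner side of the supporting hyperplane. -/
theorem inner_sub_pos_of_mem_gaussMap (hr : 0 < r) (h : Metric.ball c r ⊆ (K : Set (E d)))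
    {X : E d} {ν : S d} (hν : ν ∈ gaussMap K X) : 0 < ⟪X - c, (ν : E d)⟫ := by
  have hn : ‖(ν : E d)‖ = 1 := by simp
  have := hν (c + (r / 2) • (ν : E d)) (h (by simp [dist_eq_norm, norm_smul, hn, abs_of_pos hr, hr]))
  rw [inner_add_left, inner_smul_left, real_inner_self_eq_norm_sq, hn] at this
  rw [inner_sub_left]
  simp at this
  linarith

/-- The support inequality at the boundary point `c + v / gaugeAt K c v`, made homogeneous in `v`.
-/
theorem inner_le_mul_gaugeAt (hr : 0 < r) (h : Metric.ball c r ⊆ (K : Set (E d)))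
    {X : E d} {ν : S d} (hν : ν ∈ gaussMap K X) (v : E d) :
    ⟪v, (ν : E d)⟫ ≤ ⟪X - c, (ν : E d)⟫ * gaugeAt K c v := by
  rcases eq_or_ne v 0 with rfl | hv
  · simp [gaugeAt]
  have hg := gaugeAt_pos hr h hv
  have := hν (c + (gaugeAt K c v)⁻¹ • v) ((mem_iff_gaugeAt hr h).2 (by
    rw [gaugeAt_smul (by positivity), inv_mul_cancel₀ hg.ne']))
  rw [inner_add_left, real_inner_smul_left] at this
  rw [inner_sub_left]
  have h2 : ⟪v, (ν : E d)⟫ = (gaugeAt K c v)⁻¹ * ⟪v, (ν : E d)⟫ * gaugeAt K c v := by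
    field_simp
  rw [h2]
  gcongr
  linarith

end Gauge

/-! ### Radial Lipschitz charts of the boundary and uniqueness of normals almost everywhere -/

section Chart

variable {n : ℕ}

/-- The vector of `ℝⁿ⁺¹` with `i`-th coordinate `s` and the other coordinates given by `y`. -/
def insertCoord (i : Fin (n + 1)) (s : ℝ) (y : E n) : E (n + 1) :=
  WithLp.toLp 2 (Fin.insertNth i s (WithLp.ofLp y) : Fin (n + 1) → ℝ)

/-- The vector obtained by deleting the `i`-th coordinate. -/
def removeCoord (i : Fin (n + 1)) (v : E (n + 1)) : E n :=
  WithLp.toLp 2 (fun j => v (i.succAbove j))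

theorem insertCoord_removeCoord (i : Fin (n + 1)) (v : E (n + 1)) :
    insertCoord i (v i) (removeCoord i v) = v := by
  ext j
  refine Fin.succAboveCases i ?_ (fun k => ?_) j <;> simp [insertCoord, removeCoord]

theorem insertCoord_add (i : Fin (n + 1)) (s t : ℝ) (y z : E n) :
    insertCoord i (s + t) (y + z) = insertCoord i s y + insertCoord i t z := by
  ext j
  refine Fin.succAboveCases i ?_ (fun k => ?_) j <;> simp [insertCoord]

theorem insertCoord_smul (i : Fin (n + 1)) (a s : ℝ) (y : E n) :
    insertCoord i (a * s) (a • y) = a • insertCoord i s y := by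
  ext j
  refine Fin.succAboveCases i ?_ (fun k => ?_) j <;> simp [insertCoord]

theorem inner_insertCoord (i : Fin (n + 1)) (s t : ℝ) (y z : E n) :
    ⟪insertCoord i s y, insertCoord i t z⟫ = s * t + ⟪y, z⟫ := by
  simp [PiLp.inner_apply, Fin.sum_univ_succAbove _ i, insertCoord, mul_comm]

theorem norm_insertCoord_sq (i : Fin (n + 1)) (s : ℝ) (y : E n) :
    ‖insertCoord i s y‖ ^ 2 = s ^ 2 + ‖y‖ ^ 2 := by
  rw [← real_inner_self_eq_norm_sq, inner_insertCoord, real_inner_self_eq_norm_sq, ← sq]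

theorem insertCoord_sub (i : Fin (n + 1)) (s : ℝ) (y z : E n) :
    insertCoord i s y - insertCoord i s z = insertCoord i 0 (y - z) := by
  have := insertCoord_add i s 0 z (y - z)
  rw [add_zero, add_sub_cancel] at this
  rw [this, add_sub_cancel_left]

theorem norm_insertCoord_zero (i : Fin (n + 1)) (y : E n) : ‖insertCoord i 0 y‖ = ‖y‖ := by
  have := norm_insertCoord_sq i 0 y
  rw [← sq_eq_sq₀ (norm_nonneg _) (norm_nonneg _), this]; ring

theorem prH_insertCoord_last (s : ℝ) (y : E n) : prH (insertCoord (Fin.last n) s y) = y := by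
  ext j
  simp only [prH, insertCoord, ← Fin.succAbove_last_apply, Fin.insertNth_apply_succAbove]

theorem prH_eq_removeCoord (v : E (n + 1)) : prH v = removeCoord (Fin.last n) v := by
  ext j
  simp [prH, removeCoord]

/-- The point in which the ray from `c` in the direction `insertCoord i s y` meets `∂K`. -/
def chart (K : ConvexBody (E (n + 1))) (c : E (n + 1)) (i : Fin (n + 1)) (s : ℝ) (y : E n) :
    E (n + 1) :=
  c + (gaugeAt K c (insertCoord i s y))⁻¹ • insertCoord i s y

variable {K : ConvexBody (E (n + 1))} {c : E (n + 1)} {i : Fin (n + 1)} {s : ℝ}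

theorem insertCoord_ne_zero (hs : s ≠ 0) (y : E n) : insertCoord i s y ≠ 0 := fun h => by
  have := norm_insertCoord_sq i s y
  rw [h, norm_zero] at this
  nlinarith [sq_nonneg ‖y‖, sq_pos_of_ne_zero hs]

theorem one_le_norm_insertCoord (hs : s ^ 2 = 1) (y : E n) : 1 ≤ ‖insertCoord i s y‖ := by
  have := norm_insertCoord_sq i s y
  nlinarith [sq_nonneg ‖y‖, norm_nonneg (insertCoord i s y)]

theorem norm_insertCoord_le (hs : s ^ 2 = 1) (y : E n) : ‖insertCoord i s y‖ ≤ 1 + ‖y‖ := by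
  have := norm_insertCoord_sq i s y
  nlinarith [norm_nonneg y, norm_nonneg (insertCoord i s y)]

theorem chart_removeCoord {r : ℝ} (hr : 0 < r) (h : Metric.ball c r ⊆ (K : Set (E (n + 1))))
    {X : E (n + 1)} (hX : X ∈ frontier (K : Set (E (n + 1)))) (hi : (X - c) i ≠ 0) :
    chart K c i ((X - c) i / |(X - c) i|) (|(X - c) i|⁻¹ • removeCoord i (X - c)) = X := by
  set v := X - c with hv
  have hXv : X = c + v := by simp [hv]
  have hg : gaugeAt K c v = 1 := (mem_frontier_iff_gaugeAt hr h).1 (hXv ▸ hX)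
  have h0 : 0 < |v i| := abs_pos.2 hi
  rw [chart, div_eq_inv_mul, insertCoord_smul, insertCoord_removeCoord, gaugeAt_smul (by positivity),
    hg, hXv, mul_one, inv_inv, smul_smul, mul_inv_cancel₀ h0.ne', one_smul]

/-- With `s = ±1` the direction has norm between `1` and `1 + ρ`. Hence the inverse gauge is at most
`R`, while the gauge itself is `1 / r`-Lipschitz. The constant depends on the body only through `r`
and `R`, which makes later estimates uniform along the sequence. -/
theorem lipschitzOnWith_chart {r R ρ : ℝ} (hr : 0 < r) (hR : 0 < R) (hρ : 0 < ρ)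
    (h : Metric.ball c r ⊆ (K : Set (E (n + 1))))
    (h' : (K : Set (E (n + 1))) ⊆ Metric.closedBall c R) (hs : s ^ 2 = 1) :
    LipschitzOnWith (Real.toNNReal (R + (ρ + 1) * R ^ 2 / r)) (chart K c i s)
      (Metric.closedBall 0 ρ) := by
  refine LipschitzOnWith.of_dist_le_mul fun y hy z hz => ?_
  rw [Real.coe_toNNReal _ (by positivity)]
  lift r to ℝ≥0 using hr.le
  have hG := (lipschitzWith_gaugeAt (by exact_mod_cast hr) h).dist_le_mul
    (insertCoord i s z) (insertCoord i s y)
  rw [dist_eq_norm (insertCoord i s z), insertCoord_sub, norm_insertCoord_zero] at hG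
  have hy1 := one_le_norm_insertCoord (i := i) hs y
  have hz1 := one_le_norm_insertCoord (i := i) hs z
  have hz2 := norm_insertCoord_le (i := i) hs z
  have hyg := norm_le_mul_gaugeAt hr h hR h' (insertCoord i s y)
  have hzg := norm_le_mul_gaugeAt hr h hR h' (insertCoord i s z)
  have hsub := insertCoord_sub i s y z
  have hns := norm_insertCoord_zero i (y - z)
  simp only [chart]
  set v := insertCoord i s y
  set w := insertCoord i s z
  set a := gaugeAt K c v
  set b := gaugeAt K c w
  have ha : 0 < a := pos_of_mul_pos_right (by linarith) hR.le
  have hb : 0 < b := pos_of_mul_pos_right (by linarith) hR.le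
  have ha' : a⁻¹ ≤ R := by rw [inv_le_iff_one_le_mul₀ ha]; linarith
  have hb' : b⁻¹ ≤ R := by rw [inv_le_iff_one_le_mul₀ hb]; linarith
  have key : a⁻¹ • v - b⁻¹ • w = a⁻¹ • (v - w) + (a⁻¹ * b⁻¹ * (b - a)) • w := by
    have : a⁻¹ * b⁻¹ * (b - a) = a⁻¹ - b⁻¹ := by field_simp
    rw [this]; module
  rw [dist_eq_norm, add_sub_add_left_eq_sub, key, dist_eq_norm]
  refine (norm_add_le _ _).trans ?_
  rw [norm_smul, norm_smul, hsub, hns, norm_mul, norm_mul, Real.norm_of_nonneg (inv_pos.2 ha).le,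
    Real.norm_of_nonneg (inv_pos.2 hb).le]
  rw [dist_eq_norm, norm_sub_rev z, NNReal.coe_inv] at hG
  have hw : ‖w‖ ≤ ρ + 1 := by
    have : ‖z‖ ≤ ρ := by simpa using hz
    linarith
  calc a⁻¹ * ‖y - z‖ + a⁻¹ * b⁻¹ * ‖b - a‖ * ‖w‖
      ≤ R * ‖y - z‖ + R * R * ((r : ℝ)⁻¹ * ‖y - z‖) * (ρ + 1) := by gcongr
    _ = (R + (ρ + 1) * R ^ 2 / r) * ‖y - z‖ := by field_simp

/-- Rays from `c` are parametrized by the faces of the cube `[-1, 1]ⁿ⁺¹`: divide `X - c` by its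
coordinate of largest modulus. -/
theorem frontier_subset_iUnion_chart {r : ℝ} (hr : 0 < r)
    (h : Metric.ball c r ⊆ (K : Set (E (n + 1)))) :
    frontier (K : Set (E (n + 1))) ⊆
      ⋃ i : Fin (n + 1), ⋃ s ∈ ({1, -1} : Set ℝ), chart K c i s '' Metric.closedBall 0 (n + 1) := by
  intro X hX
  obtain ⟨i, -, hi⟩ := Finset.exists_max_image Finset.univ (fun i => |(X - c) i|) ⟨0, Finset.mem_univ _⟩
  have hXc : X - c ≠ 0 := fun h0 => by
    have := (mem_frontier_iff_gaugeAt (v := X - c) hr h).1 (by simpa using hX)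
    rw [h0] at this
    simp [gaugeAt] at this
  have hi0 : (X - c) i ≠ 0 := fun h0 => hXc (by
    ext j
    have := hi j (Finset.mem_univ j)
    rw [h0, abs_zero] at this
    simpa using abs_nonpos_iff.1 this)
  refine mem_iUnion.2 ⟨i, mem_iUnion₂.2 ⟨(X - c) i / |(X - c) i|, ?_,
    |(X - c) i|⁻¹ • removeCoord i (X - c), ?_, chart_removeCoord hr h hX hi0⟩⟩
  · rcases lt_or_gt_of_ne hi0 with h1 | h1
    · right; rw [abs_of_neg h1, div_neg, div_self hi0]; rfl
    · left; rw [abs_of_pos h1, div_self hi0]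
  -- The rescaled coordinates have modulus at most `1`, so the norm is at most `√n ≤ n + 1`.
  · rw [mem_closedBall_zero_iff, norm_smul, norm_inv, Real.norm_eq_abs, abs_abs,
      inv_mul_le_iff₀ (abs_pos.2 hi0)]
    refine abs_le_of_sq_le_sq' ?_ (by positivity) |>.2
    rw [EuclideanSpace.real_norm_sq_eq, mul_pow]
    calc ∑ j, removeCoord i (X - c) j ^ 2 ≤ ∑ j : Fin n, |(X - c) i| ^ 2 := by
          refine Finset.sum_le_sum fun j _ => ?_
          rw [← sq_abs (removeCoord i (X - c) j)]
          exact pow_le_pow_left₀ (abs_nonneg _) (hi _ (Finset.mem_univ _)) 2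
      _ = n * |(X - c) i| ^ 2 := by simp
      _ ≤ |(X - c) i| ^ 2 * (n + 1) ^ 2 := by
          rw [mul_comm]
          gcongr
          nlinarith [(n.cast_nonneg : (0 : ℝ) ≤ n)]

theorem euclideanHausdorffMeasure_frontier_lt_top (hK : (interior (K : Set (E (n + 1)))).Nonempty) :
    (μHE[n] : Measure (E (n + 1))) (frontier (K : Set (E (n + 1)))) < ∞ := by
  obtain ⟨c, hc⟩ := hK
  obtain ⟨r, hr, h⟩ := Metric.isOpen_iff.1 isOpen_interior c hc
  replace h := h.trans interior_subset
  obtain ⟨R, hR, h'⟩ := K.isBounded.subset_closedBall_lt 0 c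
  refine (measure_mono (frontier_subset_iUnion_chart hr h)).trans_lt ?_
  refine (measure_iUnion_le _).trans_lt ?_
  rw [tsum_fintype, ENNReal.sum_lt_top]
  intro i _
  refine measure_biUnion_lt_top (by simp) fun s hs => ?_
  have hs : s ^ 2 = 1 := by rcases hs with rfl | rfl <;> norm_num
  refine (euclideanHausdorffMeasure_image_le
    (lipschitzOnWith_chart hr hR (by positivity) h h' hs) n).trans_lt ?_
  rw [EuclideanSpace.euclideanHausdorffMeasure_eq_volume]
  exact ENNReal.mul_lt_top (by simp) measure_closedBall_lt_top

/-- For a normal `ν` at `X`, the vector `ν / ⟪X - c, ν⟫` is the gradient of the gauge, so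
differentiability determines it, and `‖ν‖ = 1` fixes the scale. Differentiability along the cube
face is enough, because homogeneity supplies the radial direction. -/
theorem gaussMap_chart_subsingleton {r : ℝ} (hr : 0 < r)
    (h : Metric.ball c r ⊆ (K : Set (E (n + 1)))) (hs : s ≠ 0) {y : E n}
    (hd : DifferentiableAt ℝ (fun y => gaugeAt K c (insertCoord i s y)) y) :
    (gaussMap K (chart K c i s y)).Subsingleton := by
  set X := chart K c i s y with hX
  have key : ∀ ν ∈ gaussMap K X, (∀ w, ⟪insertCoord i 0 w, (ν : E (n + 1))⟫ = ⟪X - c, (ν : E (n + 1))⟫ *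
      fderiv ℝ (fun y => gaugeAt K c (insertCoord i s y)) y w) ∧
      ⟪insertCoord i s y, (ν : E (n + 1))⟫ =
        ⟪X - c, (ν : E (n + 1))⟫ * gaugeAt K c (insertCoord i s y) := by
    intro ν hν
    have hg := gaugeAt_pos hr h (insertCoord_ne_zero (i := i) hs y)
    have h2 : ⟪insertCoord i s y, (ν : E (n + 1))⟫ =
        ⟪X - c, (ν : E (n + 1))⟫ * gaugeAt K c (insertCoord i s y) := by
      rw [hX, chart, add_sub_cancel_left, real_inner_smul_left]
      field_simp
    refine ⟨fun w => ?_, h2⟩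
    have hl : HasDerivAt (fun t : ℝ => gaugeAt K c (insertCoord i s (y + t • w)))
        (fderiv ℝ (fun y => gaugeAt K c (insertCoord i s y)) y w) 0 :=
      hd.hasFDerivAt.hasLineDerivAt w
    have hl2 := (hl.const_mul ⟪X - c, (ν : E (n + 1))⟫).sub
      (((hasDerivAt_id (0 : ℝ)).mul_const ⟪insertCoord i 0 w, (ν : E (n + 1))⟫).const_add
        ⟪insertCoord i s y, (ν : E (n + 1))⟫)
    -- The inequality `inner_le_mul_gaugeAt` is an equality at `t = 0`, so the difference of its
    -- sides is minimal there.
    have hmin : IsLocalMin ((fun t : ℝ => ⟪X - c, (ν : E (n + 1))⟫ *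
        gaugeAt K c (insertCoord i s (y + t • w))) - fun t : ℝ => ⟪insertCoord i s y, (ν : E (n + 1))⟫ +
          id t * ⟪insertCoord i 0 w, (ν : E (n + 1))⟫) 0 := by
      refine Eventually.of_forall fun t => ?_
      have e : insertCoord i s (y + t • w) = insertCoord i s y + t • insertCoord i 0 w := by
        rw [← insertCoord_smul, ← insertCoord_add, mul_zero, add_zero]
      have := inner_le_mul_gaugeAt hr h hν (insertCoord i s (y + t • w))
      have e2 : ⟪insertCoord i s (y + t • w), (ν : E (n + 1))⟫ = ⟪insertCoord i s y, (ν : E (n + 1))⟫ +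
          t * ⟪insertCoord i 0 w, (ν : E (n + 1))⟫ := by
        rw [e, inner_add_left, real_inner_smul_left]
      simp only [Pi.sub_apply, id, zero_smul, add_zero, zero_mul]
      rw [h2, sub_self]
      linarith
    have := hmin.hasDerivAt_eq_zero hl2
    linarith
  intro ν hν ν' hν'
  obtain ⟨k1, k2⟩ := key ν hν
  obtain ⟨l1, l2⟩ := key ν' hν'
  have ha := inner_sub_pos_of_mem_gaussMap hr h hν
  have hb := inner_sub_pos_of_mem_gaussMap hr h hν'
  set a := ⟪X - c, (ν : E (n + 1))⟫
  set b := ⟪X - c, (ν' : E (n + 1))⟫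
  -- This vector is orthogonal to the face directions and to the ray. These span the space since `s
  -- ≠ 0`, so it vanishes.
  set u : E (n + 1) := b • (ν : E (n + 1)) - a • (ν' : E (n + 1)) with hu
  have hu1 : ∀ w, ⟪insertCoord i 0 w, u⟫ = 0 := fun w => by
    rw [hu, inner_sub_right, real_inner_smul_right, real_inner_smul_right, k1, l1]; ring
  have hu2 : ⟪insertCoord i s y, u⟫ = 0 := by
    rw [hu, inner_sub_right, real_inner_smul_right, real_inner_smul_right, k2, l2]; ring
  have hu3 : removeCoord i u = 0 := by
    have := hu1 (removeCoord i u)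
    rw [← insertCoord_removeCoord i u, inner_insertCoord, zero_mul, zero_add,
      insertCoord_removeCoord] at this
    exact inner_self_eq_zero.1 this
  have hu4 : u i = 0 := by
    rw [← insertCoord_removeCoord i u, inner_insertCoord, hu3,
      inner_zero_right, add_zero] at hu2
    exact (mul_eq_zero.1 hu2).resolve_left hs
  have hu0 : b • (ν : E (n + 1)) = a • (ν' : E (n + 1)) := by
    rw [← sub_eq_zero, ← hu, ← insertCoord_removeCoord i u, hu3, hu4]
    have := insertCoord_smul i 0 0 (0 : E n)
    simpa using this
  have hν1 : ‖(ν : E (n + 1))‖ = 1 := by simp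
  have hν2 : ‖(ν' : E (n + 1))‖ = 1 := by simp
  have hab : b = a := by
    have := congrArg norm hu0
    rwa [norm_smul, norm_smul, hν1, hν2, mul_one, mul_one, Real.norm_of_nonneg ha.le,
      Real.norm_of_nonneg hb.le] at this
  rw [hab] at hu0
  exact Subtype.ext (smul_right_injective _ ha.ne' hu0)

/-- By Rademacher's theorem the gauge is differentiable almost everywhere on each cube face, and the
Lipschitz charts send the exceptional null sets to `ℋⁿ`-null sets. -/
theorem ae_gaussMap_subsingleton (hK : (interior (K : Set (E (n + 1)))).Nonempty) :
    ∀ᵐ X ∂(μHE[n] : Measure (E (n + 1))).restrict (frontier (K : Set (E (n + 1)))),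
      (gaussMap K X).Subsingleton := by
  obtain ⟨c, hc⟩ := hK
  obtain ⟨r, hr, h⟩ := Metric.isOpen_iff.1 isOpen_interior c hc
  replace h := h.trans interior_subset
  obtain ⟨R, hR, h'⟩ := K.isBounded.subset_closedBall_lt 0 c
  rw [ae_restrict_iff' isClosed_frontier.measurableSet, ae_iff]
  simp only [Classical.not_imp]
  set N : Fin (n + 1) → ℝ → Set (E n) := fun i s =>
    {y | ¬ DifferentiableAt ℝ (fun y => gaugeAt K c (insertCoord i s y)) y}
  refine measure_mono_null (t := ⋃ i : Fin (n + 1), ⋃ s ∈ ({1, -1} : Set ℝ),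
    chart K c i s '' (N i s ∩ Metric.closedBall 0 (n + 1))) ?_ ?_
  · rintro X ⟨hX, hX2⟩
    obtain ⟨i, hi⟩ := mem_iUnion.1 (frontier_subset_iUnion_chart hr h hX)
    obtain ⟨s, hs, y, hy, rfl⟩ := mem_iUnion₂.1 hi
    refine mem_iUnion.2 ⟨i, mem_iUnion₂.2 ⟨s, hs, y, ⟨fun hd => hX2 ?_, hy⟩, rfl⟩⟩
    exact gaussMap_chart_subsingleton hr h (by rcases hs with rfl | rfl <;> norm_num) hd
  · refine measure_iUnion_null fun i => (measure_biUnion_null_iff (by simp)).2 fun s hs => ?_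
    have hs : s ^ 2 = 1 := by rcases hs with rfl | rfl <;> norm_num
    refine le_antisymm ((euclideanHausdorffMeasure_image_le
      ((lipschitzOnWith_chart hr hR (by positivity) h h' hs).mono inter_subset_right) n).trans ?_)
        zero_le
    rw [EuclideanSpace.euclideanHausdorffMeasure_eq_volume]
    have hN : volume (N i s) = 0 := by
      lift r to ℝ≥0 using hr.le
      have h1 := lipschitzWith_gaugeAt (by exact_mod_cast hr) h
      have h2 : LipschitzWith 1 (insertCoord i s : E n → E (n + 1)) :=
        LipschitzWith.of_dist_le_mul fun y z => by
          rw [dist_eq_norm, insertCoord_sub, norm_insertCoord_zero, dist_eq_norm]; simp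
      exact ae_iff.1 (h1.comp h2).ae_differentiableAt
    rw [measure_mono_null inter_subset_left hN, mul_zero]

end Chart

/-! ### Existence and stability of outer normals -/

section Normal

variable {d : ℕ}

/-- Hahn–Banach separates `X` from the interior, and a body with interior points is the closure of
its interior. -/
theorem gaussMap_nonempty {K : ConvexBody (E d)} (hK : (interior (K : Set (E d))).Nonempty)
    {X : E d} (hX : X ∈ frontier (K : Set (E d))) : (gaussMap K X).Nonempty := by
  obtain ⟨f, hf⟩ := geometric_hahn_banach_open_point K.convex.interior isOpen_interior hX.2
  set u := (InnerProductSpace.toDual ℝ (E d)).symm f with hu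
  have hfu : ∀ v, f v = ⟪v, u⟫ := fun v => by
    rw [hu, real_inner_comm, InnerProductSpace.toDual_symm_apply]
  have hle : ∀ Y ∈ K, f Y ≤ f X := by
    have hcl : (K : Set (E d)) ⊆ {Y | f Y ≤ f X} := by
      rw [← K.isClosed.closure_eq, ← K.convex.closure_interior_eq_closure_of_nonempty_interior hK]
      exact closure_minimal (fun Y hY => (hf Y hY).le) (isClosed_le (by fun_prop) (by fun_prop))
    exact fun Y hY => hcl hY
  have hu0 : u ≠ 0 := fun h0 => by
    obtain ⟨Y, hY⟩ := hK
    have := hf Y hY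
    simp [hfu, h0] at this
  have hun : 0 < ‖u‖ := norm_pos_iff.2 hu0
  refine ⟨⟨‖u‖⁻¹ • u, by simp [norm_smul, hun.ne']⟩, fun Y hY => ?_⟩
  simp only [real_inner_smul_right]
  have := hle Y hY
  rw [hfu, hfu] at this
  gcongr

theorem tendsto_proj {ι : Type*} {l : Filter ι} {L : ι → ConvexBody (E d)} {K : ConvexBody (E d)}
    (hL : Tendsto L l (𝓝 K)) {Y : E d} (hY : Y ∈ K) : Tendsto (fun i => proj (L i) Y) l (𝓝 Y) := by
  rw [tendsto_iff_dist_tendsto_zero] at hL ⊢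
  exact squeeze_zero (fun _ => dist_nonneg)
    (fun i => by rw [dist_comm]; exact dist_proj_le_dist (L i) K hY) hL

theorem mem_gaussMap_of_tendsto {ι : Type*} {l : Filter ι} [NeBot l] {L : ι → ConvexBody (E d)}
    {K : ConvexBody (E d)} (hL : Tendsto L l (𝓝 K)) {X : ι → E d} {ν : ι → S d} {X₀ : E d} {ν₀ : S d}
    (hX : Tendsto X l (𝓝 X₀)) (hν : Tendsto ν l (𝓝 ν₀))
    (h : ∀ᶠ i in l, ν i ∈ gaussMap (L i) (X i)) : ν₀ ∈ gaussMap K X₀ := by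
  intro Y hY
  have hν' : Tendsto (fun i => (ν i : E d)) l (𝓝 ν₀) := (continuous_subtype_val.tendsto _).comp hν
  exact le_of_tendsto_of_tendsto ((tendsto_proj hL hY).inner hν') (hX.inner hν')
    (h.mono fun i hi => hi _ (proj_mem _ _))

/-- The sphere is compact, so the normals converge along every ultrafilter; by the closed graph
property the limit is a normal of `K` at `X₀`, and there is only one. -/
theorem tendsto_of_gaussMap_subsingleton {ι : Type*} {l : Filter ι} {L : ι → ConvexBody (E d)}
    {K : ConvexBody (E d)} (hL : Tendsto L l (𝓝 K)) {X : ι → E d} {ν : ι → S d} {X₀ : E d} {ν₀ : S d}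
    (hX : Tendsto X l (𝓝 X₀)) (h : ∀ᶠ i in l, ν i ∈ gaussMap (L i) (X i))
    (hs : (gaussMap K X₀).Subsingleton) (h₀ : ν₀ ∈ gaussMap K X₀) : Tendsto ν l (𝓝 ν₀) := by
  refine (tendsto_iff_ultrafilter _ _ _).2 fun U hU => ?_
  have h1 : ((U.map ν : Ultrafilter (S d)) : Filter (S d)) ≤ 𝓝 (U.map ν).lim := Ultrafilter.le_nhds_lim _
  have h2 : Tendsto ν U (𝓝 (U.map ν).lim) := h1
  rwa [← hs (mem_gaussMap_of_tendsto (hL.mono_left hU) (hX.mono_left hU) h2 (hU h)) h₀]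

end Normal

/-! ### The surface area measure as the image of the boundary measure -/

section SurfaceArea

variable {n : ℕ}

instance nonempty_sphere : Nonempty (S (n + 1)) := ⟨⟨EuclideanSpace.single 0 1, by simp⟩⟩

/-- An outer unit normal of `K` at `X`, if there is one. -/
def normal (K : ConvexBody (E (n + 1))) (X : E (n + 1)) : S (n + 1) :=
  Classical.epsilon (· ∈ gaussMap K X)

variable {K : ConvexBody (E (n + 1))}

theorem normal_mem_gaussMap (hK : (interior (K : Set (E (n + 1)))).Nonempty)
    {X : E (n + 1)} (hX : X ∈ frontier (K : Set (E (n + 1)))) : normal K X ∈ gaussMap K X :=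
  Classical.epsilon_spec (gaussMap_nonempty hK hX)

/-- The `n`-dimensional Hausdorff measure on the boundary of `K`. -/
def boundaryMeasure (K : ConvexBody (E (n + 1))) : Measure (E (n + 1)) :=
  (μHE[n] : Measure (E (n + 1))).restrict (frontier (K : Set (E (n + 1))))

theorem isFiniteMeasure_boundaryMeasure (hK : (interior (K : Set (E (n + 1)))).Nonempty) :
    IsFiniteMeasure (boundaryMeasure K) :=
  ⟨by
    rw [boundaryMeasure, Measure.restrict_apply_univ]
    exact euclideanHausdorffMeasure_frontier_lt_top hK⟩

theorem ae_boundaryMeasure_mem : ∀ᵐ X ∂boundaryMeasure K, X ∈ frontier (K : Set (E (n + 1))) :=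
  ae_restrict_mem isClosed_frontier.measurableSet

/-- Outside a null set of multiple normals, the chosen normal is continuous: this is stability of
normals for a constant sequence of bodies. -/
theorem aemeasurable_normal (hK : (interior (K : Set (E (n + 1)))).Nonempty) :
    AEMeasurable (normal K) (boundaryMeasure K) := by
  set T := toMeasurable (boundaryMeasure K) {X | ¬ (gaussMap K X).Subsingleton} with hT
  have hT0 : boundaryMeasure K T = 0 := by
    rw [hT, measure_toMeasurable]
    exact ae_iff.1 (ae_gaussMap_subsingleton hK)
  have hmem : ∀ᵐ X ∂boundaryMeasure K, X ∈ frontier (K : Set (E (n + 1))) \ T := by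
    filter_upwards [ae_boundaryMeasure_mem, measure_eq_zero_iff_ae_notMem.1 hT0] with X h1 h2
    exact ⟨h1, h2⟩
  rw [← Measure.restrict_eq_self_of_ae_mem hmem]
  refine ContinuousOn.aemeasurable (fun X hX => ?_)
    (isClosed_frontier.measurableSet.diff (measurableSet_toMeasurable _ _))
  refine tendsto_of_gaussMap_subsingleton (L := fun _ => K) (K := K) tendsto_const_nhds
    (X := id) (X₀ := X) (tendsto_id.mono_left nhdsWithin_le_nhds) ?_ ?_ (normal_mem_gaussMap hK hX.1)
  · filter_upwards [self_mem_nhdsWithin] with Y hY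
    exact normal_mem_gaussMap hK hY.1
  · by_contra hns
    exact hX.2 (subset_toMeasurable _ _ hns)

/-- Where the normal is unique, having some normal in `B` is the same as the chosen normal lying in
`B`. -/
theorem weightedSurfaceAreaMeasure_eq_map (hK : (interior (K : Set (E (n + 1)))).Nonempty)
    (w : E (n + 1) → ℝ≥0∞) :
    weightedSurfaceAreaMeasure w K = ((boundaryMeasure K).withDensity w).map (normal K) := by
  have := isFiniteMeasure_boundaryMeasure hK
  refine weightedSurfaceAreaMeasure_eq w K _ fun B hB => ?_
  rw [Measure.map_apply_of_aemeasurable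
    ((aemeasurable_normal hK).mono_ac (withDensity_absolutelyContinuous _ _)) hB,
    withDensity_apply', weightedSurfaceArea]
  have : (normal K ⁻¹' B : Set (E (n + 1))) =ᵐ[boundaryMeasure K] gaussPreimage K B := by
    filter_upwards [ae_boundaryMeasure_mem, ae_gaussMap_subsingleton hK] with X h1 h2
    refine propext ⟨fun h => ⟨h1, normal K X, normal_mem_gaussMap hK h1, h⟩, ?_⟩
    rintro ⟨-, ν, hν, hνB⟩
    change normal K X ∈ B
    rwa [h2 (normal_mem_gaussMap hK h1) hν]
  rw [Measure.restrict_congr_set this, boundaryMeasure, Measure.restrict_restrict_of_subset]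
  exact fun X hX => hX.1

end SurfaceArea

/-! ### Comparing the boundaries of two nearby bodies -/

section Sandwich

variable {d : ℕ} {L M : ConvexBody (E d)} {c : E d} {r s : ℝ}

/-- `Y` is within `dist M L` of a point of `L`, and the gauge is `1 / r`-Lipschitz. So `M` lies in a
dilate of `L`. -/
theorem gaugeAt_sub_le (hr : 0 < r) (h : Metric.ball c r ⊆ (L : Set (E d))) {Y : E d}
    (hY : Y ∈ M) : gaugeAt L c (Y - c) ≤ 1 + dist M L / r := by
  have h1 : gaugeAt L c (proj L Y - c) ≤ 1 :=
    (mem_iff_gaugeAt hr h).1 (by simpa using proj_mem L Y)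
  lift r to ℝ≥0 using hr.le
  have h2 := (lipschitzWith_gaugeAt (by exact_mod_cast hr) h).dist_le_mul (Y - c) (proj L Y - c)
  rw [dist_sub_right, Real.dist_eq] at h2
  have h3 := dist_proj_le_dist L M hY
  have h4 : ((r⁻¹ : ℝ≥0) : ℝ) * dist Y (proj L Y) ≤ dist M L / r := by
    rw [NNReal.coe_inv, div_eq_inv_mul, dist_comm M L]
    gcongr
  linarith [le_abs_self (gaugeAt L c (Y - c) - gaugeAt L c (proj L Y - c))]

/-- A point `y` of the smaller ball outside `M`, pushed a further `r / 2` away from `M`, stays in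
`L` but is farther than `r / 2` from `M`. -/
theorem ball_half_subset (hr : 0 < r) (h : Metric.ball c r ⊆ (L : Set (E d)))
    (hd : dist M L ≤ r / 2) : Metric.ball c (r / 2) ⊆ (M : Set (E d)) := by
  intro y hy
  by_contra hyM
  set P := proj M y with hP
  have hne : y - P ≠ 0 := fun h0 => hyM (by rw [sub_eq_zero.1 h0]; exact proj_mem M y)
  have hpos : 0 < ‖y - P‖ := norm_pos_iff.2 hne
  set u := ‖y - P‖⁻¹ • (y - P) with hu
  have hu1 : ‖u‖ = 1 := by rw [hu, norm_smul, norm_inv, norm_norm, inv_mul_cancel₀ hpos.ne']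
  have hyL : y + (r / 2) • u ∈ L := h (by
    rw [Metric.mem_ball] at hy ⊢
    calc dist (y + (r / 2) • u) c ≤ dist (y + (r / 2) • u) y + dist y c := dist_triangle _ _ _
      _ = r / 2 + dist y c := by
        rw [dist_eq_norm, add_sub_cancel_left, norm_smul, hu1, mul_one, Real.norm_of_nonneg]
        positivity
      _ < r := by linarith)
  set y' := y + (r / 2) • u with hy'
  have h1 : ‖y' - proj M y'‖ ≤ r / 2 := by
    rw [← dist_eq_norm]; exact (dist_proj_le_dist M L hyL).trans hd
  have h2 : ⟪u, proj M y' - P⟫ ≤ 0 := by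
    rw [hu, real_inner_smul_left]
    exact mul_nonpos_of_nonneg_of_nonpos (by positivity) (inner_proj_le M y (proj_mem M y'))
  have h3 : ⟪u, y' - proj M y'⟫ ≤ r / 2 := by
    have := real_inner_le_norm u (y' - proj M y')
    rw [hu1, one_mul] at this
    exact this.trans h1
  have h4 : ⟪u, y - P⟫ = ‖y - P‖ := by
    rw [hu, real_inner_smul_left, real_inner_self_eq_norm_sq]; field_simp
  have h5 : ⟪u, y' - P⟫ = ‖y - P‖ + r / 2 := by
    have : y' - P = (y - P) + (r / 2) • u := by rw [hy']; abel
    rw [this, inner_add_right, h4, real_inner_smul_right, real_inner_self_eq_norm_sq, hu1]; ring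
  have h6 : ⟪u, y' - P⟫ = ⟪u, y' - proj M y'⟫ + ⟪u, proj M y' - P⟫ := by
    rw [← inner_add_right]; congr 1; abel
  linarith

theorem subset_closedBall_of_dist_le {R : ℝ} (h : (L : Set (E d)) ⊆ Metric.closedBall c R)
    (hd : dist M L ≤ 1) : (M : Set (E d)) ⊆ Metric.closedBall c (R + 1) := fun Y hY => by
  have h1 := h (proj_mem L Y)
  have h2 := dist_proj_le_dist L M hY
  have h3 := dist_triangle Y (proj L Y) c
  rw [Metric.mem_closedBall] at h1 ⊢
  rw [dist_comm] at hd
  linarith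

/-- Dilate by the factor `1 + s` about `c`, then project onto `M`. -/
def dilateProj (M : ConvexBody (E d)) (c : E d) (s : ℝ) (X : E d) : E d :=
  proj M (c + (1 + s) • (X - c))

theorem lipschitzWith_dilateProj (M : ConvexBody (E d)) (c : E d) (hs : 0 ≤ s) :
    LipschitzWith (1 + s).toNNReal (dilateProj M c s) := by
  refine LipschitzWith.of_dist_le_mul fun X Y => ?_
  have := (lipschitzWith_proj M).dist_le_mul (c + (1 + s) • (X - c)) (c + (1 + s) • (Y - c))
  rw [dist_add_left, dist_smul₀, dist_sub_right, NNReal.coe_one, one_mul,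
    Real.norm_of_nonneg (by positivity)] at this
  rwa [Real.coe_toNNReal _ (by positivity)]

theorem dist_dilateProj_le (hs : 0 ≤ s) {X : E d} (hX : X ∈ L) :
    dist (dilateProj M c s X) X ≤ s * dist X c + dist M L := by
  have h1 := (lipschitzWith_proj M).dist_le_mul (c + (1 + s) • (X - c)) X
  have h2 := dist_proj_le_dist M L hX
  have h3 : c + (1 + s) • (X - c) - X = s • (X - c) := by module
  rw [NNReal.coe_one, one_mul, dist_eq_norm _ X, h3, norm_smul, Real.norm_of_nonneg hs,
    ← dist_eq_norm] at h1
  have h4 := dist_triangle (dilateProj M c s X) (proj M X) X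
  rw [dist_comm (proj M X)] at h4
  unfold dilateProj at *
  linarith

/-- If the projection of the dilated point `Z` were interior to `M`, a small move towards `Z` would
stay in `M`, forcing `Z` to be its own projection. A small move away from `c` would then stay in `M`
with gauge above `1 + s`. -/
theorem dilateProj_mem_frontier (hr : 0 < r) (h : Metric.ball c r ⊆ (L : Set (E d)))
    (hs : 0 ≤ s) (hsub : ∀ Y ∈ M, gaugeAt L c (Y - c) ≤ 1 + s) {X : E d}
    (hX : X ∈ frontier (L : Set (E d))) : dilateProj M c s X ∈ frontier (M : Set (E d)) := by
  have hg : gaugeAt L c (X - c) = 1 := (mem_frontier_iff_gaugeAt hr h).1 (by simpa using hX)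
  set Z := c + (1 + s) • (X - c) with hZ
  have hZg : gaugeAt L c (Z - c) = 1 + s := by
    rw [hZ, add_sub_cancel_left, gaugeAt_smul (by positivity), hg, mul_one]
  refine ⟨subset_closure (proj_mem M Z), fun hint => ?_⟩
  change proj M Z ∈ interior _ at hint
  have hmem : ∀ᶠ t in 𝓝[>] (0 : ℝ), ∀ v ∈ ({Z - proj M Z, Z - c} : Set (E d)), proj M Z + t • v ∈ M := by
    have hv : ∀ v : E d, ∀ᶠ t in 𝓝[>] (0 : ℝ), proj M Z + t • v ∈ M := fun v => by
      have : Tendsto (fun t : ℝ => proj M Z + t • v) (𝓝[>] 0) (𝓝 (proj M Z)) := by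
        have hc : Continuous fun t : ℝ => proj M Z + t • v := by fun_prop
        simpa using (hc.tendsto 0).mono_left nhdsWithin_le_nhds
      exact this.eventually (mem_interior_iff_mem_nhds.1 hint)
    filter_upwards [hv (Z - proj M Z), hv (Z - c)] with t h1 h2
    rintro v (rfl | rfl)
    exacts [h1, h2]
  obtain ⟨t, ht, ht0⟩ := (hmem.and self_mem_nhdsWithin).exists
  have h1 := inner_proj_le M Z (ht (Z - proj M Z) (by simp))
  rw [add_sub_cancel_left, real_inner_smul_right, real_inner_self_eq_norm_sq] at h1
  have h2 : Z = proj M Z := by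
    rw [← sub_eq_zero, ← norm_eq_zero]
    by_contra hne
    have := mul_pos ht0 (sq_pos_of_ne_zero hne)
    linarith
  have h3 := hsub _ (ht (Z - c) (by simp))
  rw [← h2] at h3
  have h4 : Z + t • (Z - c) - c = (1 + t) • (Z - c) := by module
  rw [h4, gaugeAt_smul (by positivity), hZg] at h3
  nlinarith

/-- Every point of the normal ray at `Y ∈ ∂M` projects to `Y`, and the ray must leave the dilate of
`L` through its boundary. -/
theorem frontier_subset_image_dilateProj (hM : (interior (M : Set (E d))).Nonempty) (hr : 0 < r)
    (h : Metric.ball c r ⊆ (L : Set (E d)))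
    (hs : 0 ≤ s) (hsub : ∀ Y ∈ M, gaugeAt L c (Y - c) ≤ 1 + s) :
    frontier (M : Set (E d)) ⊆ dilateProj M c s '' frontier (L : Set (E d)) := by
  intro Y hY
  obtain ⟨ν, hν⟩ := gaussMap_nonempty hM hY
  have hYM : Y ∈ M := M.isClosed.frontier_subset hY
  obtain ⟨R, hR, h'⟩ := L.isBounded.subset_closedBall_lt 0 c
  have hν1 : ‖(ν : E d)‖ = 1 := by simp
  have hcont : Continuous fun t : ℝ => gaugeAt L c (Y + t • (ν : E d) - c) := by
    have : Continuous (gaugeAt L c) := by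
      lift r to ℝ≥0 using hr.le
      exact (lipschitzWith_gaugeAt (by exact_mod_cast hr) h).continuous
    fun_prop
  -- At the right endpoint the point is at distance at least `R (1 + s)` from `c`, so its gauge is
  -- at least `1 + s`.
  obtain ⟨t, ht, hgt⟩ : ∃ t ∈ Icc (0 : ℝ) (R * (1 + s) + ‖Y - c‖),
      gaugeAt L c (Y + t • (ν : E d) - c) = 1 + s := by
    refine intermediate_value_Icc (by positivity) hcont.continuousOn ⟨?_, ?_⟩
    · simpa using hsub Y hYM
    · set t := R * (1 + s) + ‖Y - c‖ with ht
      have ht0 : 0 ≤ t := by positivity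
      have h1 := norm_le_mul_gaugeAt hr h hR h' (Y + t • (ν : E d) - c)
      have h2 := norm_sub_le_norm_add (t • (ν : E d)) (Y - c)
      rw [norm_smul, hν1, Real.norm_of_nonneg ht0, mul_one] at h2
      have h3 : t • (ν : E d) + (Y - c) = Y + t • (ν : E d) - c := by abel
      rw [h3] at h2
      have h4 : R * (1 + s) ≤ R * gaugeAt L c (Y + t • (ν : E d) - c) := by linarith
      exact le_of_mul_le_mul_left h4 hR
  refine ⟨c + (1 + s)⁻¹ • (Y + t • (ν : E d) - c), ?_, ?_⟩
  · rw [mem_frontier_iff_gaugeAt hr h, gaugeAt_smul (by positivity), hgt, inv_mul_cancel₀ (by positivity)]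
  · rw [dilateProj, add_sub_cancel_left, smul_smul, mul_inv_cancel₀ (by positivity), one_smul]
    refine eq_proj M hYM fun w hw => ?_
    have e1 : c + (Y + t • (ν : E d) - c) - Y = t • (ν : E d) := by abel
    rw [e1, real_inner_smul_left, inner_sub_right, real_inner_comm, real_inner_comm Y]
    exact mul_nonpos_of_nonneg_of_nonpos ht.1 (by linarith [hν w hw])

end Sandwich

/-! ### Weak convergence of boundary points paired with normals -/

section Convergence

variable {n : ℕ} {K L M : ConvexBody (E (n + 1))} {c : E (n + 1)} {r s : ℝ}

theorem lintegral_boundaryMeasure_le (hM : (interior (M : Set (E (n + 1)))).Nonempty) (hr : 0 < r)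
    (h : Metric.ball c r ⊆ (L : Set (E (n + 1))))
    (hs : 0 ≤ s) (hsub : ∀ Y ∈ M, gaugeAt L c (Y - c) ≤ 1 + s) (f : E (n + 1) → ℝ≥0∞) :
    ∫⁻ Y, f Y ∂boundaryMeasure M ≤
      ENNReal.ofReal (1 + s) ^ n * ∫⁻ X, f (dilateProj M c s X) ∂boundaryMeasure L :=
  (lintegral_mono_set (frontier_subset_image_dilateProj hM hr h hs hsub)).trans
    (setLIntegral_image_le isClosed_frontier.measurableSet
      (lipschitzWith_dilateProj M c hs).lipschitzOnWith f)

/-- Convergence to a body with an interior ball, in quantitative form. -/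
theorem eventually_uniform_bounds {R : ℝ} {Km : ℕ → ConvexBody (E (n + 1))}
    (hKm : Tendsto Km atTop (𝓝 K)) (hr : 0 < r) (h : Metric.ball c r ⊆ (K : Set (E (n + 1))))
    (h' : (K : Set (E (n + 1))) ⊆ Metric.closedBall c R) :
    ∀ᶠ m in atTop, Metric.ball c (r / 2) ⊆ (Km m : Set (E (n + 1))) ∧
      (Km m : Set (E (n + 1))) ⊆ Metric.closedBall c (R + 1) := by
  rw [tendsto_iff_dist_tendsto_zero] at hKm
  filter_upwards [hKm.eventually (ge_mem_nhds (half_pos hr)), hKm.eventually (ge_mem_nhds one_pos)]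
    with m h1 h2
  exact ⟨ball_half_subset hr h h1, subset_closedBall_of_dist_le h' h2⟩

theorem interior_nonempty_of_ball_subset (hr : 0 < r) (h : Metric.ball c r ⊆ (K : Set (E (n + 1)))) :
    (interior (K : Set (E (n + 1)))).Nonempty :=
  ⟨c, mem_interior.2 ⟨_, h, Metric.isOpen_ball, Metric.mem_ball_self hr⟩⟩

theorem tendsto_ofReal_one_add_pow {s : ℕ → ℝ} (hs : Tendsto s atTop (𝓝 0)) :
    Tendsto (fun m => ENNReal.ofReal (1 + s m) ^ n) atTop (𝓝 1) := by
  have h1 := (ENNReal.tendsto_ofReal (hs.const_add 1))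
  rw [add_zero, ENNReal.ofReal_one] at h1
  simpa [Function.comp_def] using ((ENNReal.continuous_pow n).tendsto 1).comp h1

/-- If the sums converge and neither summand can exceed its limit asymptotically, neither can fall
short. -/
theorem tendsto_of_limsup_le_of_limsup_sub_le {a b : ℕ → ℝ≥0∞} {a₀ b₀ : ℝ≥0∞} (hb : b₀ ≠ ∞)
    (ha : limsup a atTop ≤ a₀) (hb' : limsup b atTop ≤ b₀)
    (hab : Tendsto (fun m => a m + b m) atTop (𝓝 (a₀ + b₀))) : Tendsto a atTop (𝓝 a₀) := by
  refine tendsto_of_le_liminf_of_limsup_le ?_ ha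
  refine ENNReal.le_of_forall_pos_le_add fun ε hε _ => ?_
  have h1 : ∀ᶠ m in atTop, b m ≤ b₀ + ε := by
    refine (eventually_lt_of_limsup_lt (hb'.trans_lt ?_)).mono fun _ => le_of_lt
    exact ENNReal.lt_add_right hb (by exact_mod_cast hε.ne')
  have h2 : a₀ + b₀ ≤ liminf a atTop + (b₀ + ε) := by
    rw [← hab.liminf_eq, ← liminf_add_const atTop a (b₀ + ε) (by isBoundedDefault)
      (by isBoundedDefault)]
    exact liminf_le_liminf (h1.mono fun m hm => by gcongr)
  rw [add_comm b₀, ← add_assoc] at h2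
  exact (ENNReal.add_le_add_iff_right hb).1 h2

variable {Km : ℕ → ConvexBody (E (n + 1))}

/-- Pull the integrals back to `∂K` by the maps `dilateProj`. These tend to the identity, the
normals at the image points converge almost everywhere, and reverse Fatou applies on the finite
measure of `∂K`. -/
theorem limsup_lintegral_boundaryMeasure_le (hK : (interior (K : Set (E (n + 1)))).Nonempty)
    (hKm : Tendsto Km atTop (𝓝 K)) {g : E (n + 1) × S (n + 1) → ℝ} (hg : Continuous g) {M : ℝ}
    (hM : ∀ p, g p ≤ M) :
    limsup (fun m => ∫⁻ X, ENNReal.ofReal (g (X, normal (Km m) X)) ∂boundaryMeasure (Km m)) atTop ≤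
      ∫⁻ X, ENNReal.ofReal (g (X, normal K X)) ∂boundaryMeasure K := by
  have hfin := isFiniteMeasure_boundaryMeasure hK
  obtain ⟨c, hc⟩ := id hK
  obtain ⟨r, hr, h⟩ := Metric.isOpen_iff.1 isOpen_interior c hc
  replace h := h.trans interior_subset
  obtain ⟨R, hR, h'⟩ := K.isBounded.subset_closedBall_lt 0 c
  set s : ℕ → ℝ := fun m => dist (Km m) K / r
  have hs0 : ∀ m, 0 ≤ s m := fun m => by positivity
  have hd : Tendsto (fun m => dist (Km m) K) atTop (𝓝 0) := tendsto_iff_dist_tendsto_zero.1 hKm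
  have hs : Tendsto s atTop (𝓝 0) := by simpa using hd.div_const r
  have hev := eventually_uniform_bounds hKm hr h h'
  set A : ℕ → ℝ≥0∞ := fun m => ∫⁻ X, ENNReal.ofReal (g (dilateProj (Km m) c (s m) X,
    normal (Km m) (dilateProj (Km m) c (s m) X))) ∂boundaryMeasure K
  have hA : limsup A atTop ≤ ∫⁻ X, ENNReal.ofReal (g (X, normal K X)) ∂boundaryMeasure K := by
    refine limsup_lintegral_le_of_ae_tendsto (M := ENNReal.ofReal M) ENNReal.ofReal_ne_top
      (fun m X => ENNReal.ofReal_le_ofReal (hM _)) ?_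
    filter_upwards [ae_boundaryMeasure_mem, ae_gaussMap_subsingleton hK] with X h1 h2
    have hQ : Tendsto (fun m => dilateProj (Km m) c (s m) X) atTop (𝓝 X) := by
      rw [tendsto_iff_dist_tendsto_zero]
      refine squeeze_zero (fun _ => dist_nonneg)
        (fun m => dist_dilateProj_le (hs0 m) (K.isClosed.frontier_subset h1)) ?_
      simpa using (hs.mul_const (dist X c)).add hd
    have hν : Tendsto (fun m => normal (Km m) (dilateProj (Km m) c (s m) X)) atTop
        (𝓝 (normal K X)) := by
      refine tendsto_of_gaussMap_subsingleton hKm hQ ?_ h2 (normal_mem_gaussMap hK h1)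
      filter_upwards [hev] with m hm
      exact normal_mem_gaussMap (interior_nonempty_of_ball_subset (half_pos hr) hm.1)
        (dilateProj_mem_frontier hr h (hs0 m) (fun Y hY => gaugeAt_sub_le hr h hY) h1)
    exact ENNReal.tendsto_ofReal ((hg.tendsto _).comp (hQ.prodMk_nhds hν))
  have h1 : Tendsto (fun m => ENNReal.ofReal (1 + s m) ^ n) atTop (𝓝 1) := tendsto_ofReal_one_add_pow hs
  calc _ ≤ limsup ((fun m => ENNReal.ofReal (1 + s m) ^ n) * A) atTop := by
        refine limsup_le_limsup ?_
        filter_upwards [hev] with m hm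
        exact lintegral_boundaryMeasure_le (interior_nonempty_of_ball_subset (half_pos hr) hm.1) hr h
          (hs0 m) (fun Y hY => gaugeAt_sub_le hr h hY)
          (fun X => ENNReal.ofReal (g (X, normal (Km m) X)))
    _ ≤ limsup (fun m => ENNReal.ofReal (1 + s m) ^ n) atTop * limsup A atTop :=
        ENNReal.limsup_mul_le' (Or.inl (by simp [h1.limsup_eq])) (Or.inl (by simp [h1.limsup_eq]))
    _ ≤ _ := by rwa [h1.limsup_eq, one_mul]

theorem tendsto_boundaryMeasure_univ (hK : (interior (K : Set (E (n + 1)))).Nonempty)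
    (hKm : Tendsto Km atTop (𝓝 K)) :
    Tendsto (fun m => boundaryMeasure (Km m) univ) atTop (𝓝 (boundaryMeasure K univ)) := by
  have hup := limsup_lintegral_boundaryMeasure_le hK hKm (g := fun _ => 1) continuous_const
    (M := 1) (fun _ => le_rfl)
  simp only [ENNReal.ofReal_one, lintegral_const, one_mul] at hup
  refine tendsto_of_le_liminf_of_limsup_le ?_ hup
  obtain ⟨c, hc⟩ := id hK
  obtain ⟨r, hr, h⟩ := Metric.isOpen_iff.1 isOpen_interior c hc
  replace h := h.trans interior_subset
  obtain ⟨R, hR, h'⟩ := K.isBounded.subset_closedBall_lt 0 c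
  -- The roles are exchanged: `∂K` is now the image of `∂(Km m)`, and `Km m` eventually contains the
  -- ball of radius `r / 2` about `c`.
  set s : ℕ → ℝ := fun m => dist K (Km m) / (r / 2)
  have hs0 : ∀ m, 0 ≤ s m := fun m => by positivity
  have hd : Tendsto (fun m => dist K (Km m)) atTop (𝓝 0) := by
    simpa [dist_comm] using tendsto_iff_dist_tendsto_zero.1 hKm
  have hs : Tendsto s atTop (𝓝 0) := by simpa using hd.div_const (r / 2)
  have h1 : Tendsto (fun m => (ENNReal.ofReal (1 + s m) ^ n)⁻¹) atTop (𝓝 1) := by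
    simpa using (tendsto_inv_iff.2 (tendsto_ofReal_one_add_pow (n := n) hs))
  have hfin := isFiniteMeasure_boundaryMeasure hK
  have h2 : Tendsto (fun m => (ENNReal.ofReal (1 + s m) ^ n)⁻¹ * boundaryMeasure K univ) atTop
      (𝓝 (boundaryMeasure K univ)) := by
    simpa using ENNReal.Tendsto.mul_const h1 (Or.inl one_ne_zero)
  rw [← h2.liminf_eq]
  refine liminf_le_liminf ?_
  filter_upwards [eventually_uniform_bounds hKm hr h h'] with m hm
  have := lintegral_boundaryMeasure_le hK (half_pos hr) hm.1 (hs0 m)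
    (fun Y hY => gaugeAt_sub_le (half_pos hr) hm.1 hY) 1
  simp only [Pi.one_apply, lintegral_one] at this
  have hp : 0 < ENNReal.ofReal (1 + s m) := ENNReal.ofReal_pos.2 (by linarith [hs0 m])
  rw [mul_comm, ← div_eq_mul_inv]
  exact ENNReal.div_le_of_le_mul' this

theorem aemeasurable_comp_normal (hK : (interior (K : Set (E (n + 1)))).Nonempty)
    {g : E (n + 1) × S (n + 1) → ℝ} (hg : Continuous g) :
    AEMeasurable (fun X => g (X, normal K X)) (boundaryMeasure K) :=
  hg.measurable.comp_aemeasurable (aemeasurable_id.prodMk (aemeasurable_normal hK))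

theorem tendsto_lintegral_boundaryMeasure (hK : (interior (K : Set (E (n + 1)))).Nonempty)
    (hKm : Tendsto Km atTop (𝓝 K)) {g : E (n + 1) × S (n + 1) → ℝ} (hg : Continuous g) {M : ℝ}
    (h0 : ∀ p, 0 ≤ g p) (hM : ∀ p, g p ≤ M) :
    Tendsto (fun m => ∫⁻ X, ENNReal.ofReal (g (X, normal (Km m) X)) ∂boundaryMeasure (Km m)) atTop
      (𝓝 (∫⁻ X, ENNReal.ofReal (g (X, normal K X)) ∂boundaryMeasure K)) := by
  have hfin := isFiniteMeasure_boundaryMeasure hK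
  have hsum : ∀ L : ConvexBody (E (n + 1)), (interior (L : Set (E (n + 1)))).Nonempty →
      ∫⁻ X, ENNReal.ofReal (g (X, normal L X)) ∂boundaryMeasure L +
      ∫⁻ X, ENNReal.ofReal (M - g (X, normal L X)) ∂boundaryMeasure L =
      ENNReal.ofReal M * boundaryMeasure L univ := fun L hL => by
    rw [← lintegral_add_left' (aemeasurable_comp_normal hL hg).ennreal_ofReal]
    simp_rw [← ENNReal.ofReal_add (h0 _) (sub_nonneg.2 (hM _)), add_sub_cancel]
    rw [lintegral_const]
  refine tendsto_of_limsup_le_of_limsup_sub_le ?_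
    (limsup_lintegral_boundaryMeasure_le hK hKm hg hM)
    (limsup_lintegral_boundaryMeasure_le hK hKm (g := fun p => M - g p) (by fun_prop) (M := M)
      (fun p => by linarith [h0 p])) ?_
  · have := hsum K hK
    intro htop
    rw [htop, add_top] at this
    exact ENNReal.mul_ne_top ENNReal.ofReal_ne_top (measure_ne_top _ _) this.symm
  · rw [hsum K hK]
    refine Tendsto.congr' ?_ (ENNReal.Tendsto.const_mul (tendsto_boundaryMeasure_univ hK hKm)
      (Or.inr ENNReal.ofReal_ne_top))
    obtain ⟨c, hc⟩ := id hK
    obtain ⟨r, hr, h⟩ := Metric.isOpen_iff.1 isOpen_interior c hc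
    obtain ⟨R, hR, h'⟩ := K.isBounded.subset_closedBall_lt 0 c
    filter_upwards [eventually_uniform_bounds hKm hr (h.trans interior_subset) h'] with m hm
    exact (hsum _ (interior_nonempty_of_ball_subset (half_pos hr) hm.1)).symm

/-- Weak convergence of the joint distribution of boundary point and outer unit normal. -/
theorem tendsto_integral_boundaryMeasure (hK : (interior (K : Set (E (n + 1)))).Nonempty)
    (hKm : Tendsto Km atTop (𝓝 K)) {g : E (n + 1) × S (n + 1) → ℝ} (hg : Continuous g) :
    Tendsto (fun m => ∫ X, g (X, normal (Km m) X) ∂boundaryMeasure (Km m)) atTop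
      (𝓝 (∫ X, g (X, normal K X) ∂boundaryMeasure K)) := by
  obtain ⟨c, hc⟩ := id hK
  obtain ⟨r, hr, h⟩ := Metric.isOpen_iff.1 isOpen_interior c hc
  replace h := h.trans interior_subset
  obtain ⟨R, hR, h'⟩ := K.isBounded.subset_closedBall_lt 0 c
  obtain ⟨M, hM⟩ := ((isCompact_closedBall c (R + 1)).prod
    (isCompact_univ (X := S (n + 1)))).exists_bound_of_continuousOn hg.continuousOn
  have hM0 : 0 ≤ M := (norm_nonneg _).trans
    (hM (c, Classical.arbitrary _) ⟨Metric.mem_closedBall_self (by positivity), mem_univ _⟩)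
  -- A globally bounded, nonnegative function that equals `g + M` on a compact set containing all
  -- relevant boundary points and normals.
  set g' : E (n + 1) × S (n + 1) → ℝ := fun p => max 0 (min (2 * M) (g p + M)) with hg'
  have hg'c : Continuous g' := by fun_prop
  have hg'0 : ∀ p, 0 ≤ g' p := fun p => le_max_left _ _
  have hg'M : ∀ p, g' p ≤ 2 * M := fun p => max_le (by positivity) (min_le_left _ _)
  have hint : ∀ L : ConvexBody (E (n + 1)), (interior (L : Set (E (n + 1)))).Nonempty →
      (L : Set (E (n + 1))) ⊆ Metric.closedBall c (R + 1) →
      ∫ X, g (X, normal L X) ∂boundaryMeasure L =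
        (∫⁻ X, ENNReal.ofReal (g' (X, normal L X)) ∂boundaryMeasure L).toReal -
          M * (boundaryMeasure L univ).toReal := fun L hL hLR => by
    have hfin := isFiniteMeasure_boundaryMeasure hL
    rw [← integral_eq_lintegral_of_nonneg_ae (ae_of_all _ fun X => hg'0 _)
      (aemeasurable_comp_normal hL hg'c).aestronglyMeasurable]
    have hi : Integrable (fun X => g' (X, normal L X)) (boundaryMeasure L) :=
      Integrable.of_bound (aemeasurable_comp_normal hL hg'c).aestronglyMeasurable (2 * M)
        (ae_of_all _ fun X => by rw [Real.norm_of_nonneg (hg'0 _)]; exact hg'M _)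
    have : M * (boundaryMeasure L univ).toReal = ∫ X, M ∂boundaryMeasure L := by
      rw [integral_const, smul_eq_mul, mul_comm]; rfl
    rw [this, ← integral_sub hi (integrable_const _)]
    refine integral_congr_ae ?_
    filter_upwards [ae_boundaryMeasure_mem] with X hX
    have := hM (X, normal L X) ⟨hLR (L.isClosed.frontier_subset hX), mem_univ _⟩
    rw [Real.norm_eq_abs, abs_le] at this
    simp only [hg']
    rw [min_eq_right (by linarith), max_eq_right (by linarith)]
    ring
  have hfin := isFiniteMeasure_boundaryMeasure hK
  rw [hint K hK (h'.trans (Metric.closedBall_subset_closedBall (by linarith)))]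
  have hlim := tendsto_lintegral_boundaryMeasure hK hKm hg'c hg'0 hg'M
  have hne : ∫⁻ X, ENNReal.ofReal (g' (X, normal K X)) ∂boundaryMeasure K ≠ ∞ := by
    refine ne_top_of_le_ne_top ?_ (lintegral_mono fun X => ENNReal.ofReal_le_ofReal (hg'M _))
    rw [lintegral_const]
    exact ENNReal.mul_ne_top ENNReal.ofReal_ne_top (measure_ne_top _ _)
  refine Tendsto.congr' ?_ (((ENNReal.tendsto_toReal hne).comp hlim).sub
    (((ENNReal.tendsto_toReal (measure_ne_top _ _)).comp
      (tendsto_boundaryMeasure_univ hK hKm)).const_mul M))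
  filter_upwards [eventually_uniform_bounds hKm hr h h'] with m hm
  exact (hint _ (interior_nonempty_of_ball_subset (half_pos hr) hm.1) hm.2).symm

end Convergence

/-! ### Local integrability of the density and convergence of the weighted volumes -/

section Density

variable {n : ℕ} {q : ℝ} {Ψ : E (n + 1) → ℝ}

theorem prH_add (X Y : E (n + 1)) : prH (X + Y) = prH X + prH Y := by ext; simp [prH]

theorem prH_smul (t : ℝ) (X : E (n + 1)) : prH (t • X) = t • prH X := by ext; simp [prH]

theorem continuous_prH : Continuous (prH : E (n + 1) → E n) := by unfold prH; fun_prop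

theorem norm_sq_eq_add_norm_prH_sq (X : E (n + 1)) :
    ‖X‖ ^ 2 = X (Fin.last n) ^ 2 + ‖prH X‖ ^ 2 := by
  conv_lhs => rw [← insertCoord_removeCoord (Fin.last n) X]
  rw [norm_insertCoord_sq, prH_eq_removeCoord]

theorem measurable_density (hΨ : Continuous Ψ) : Measurable (density q Ψ) := by
  have h1 : Measurable fun X : E (n + 1) => ‖prH X‖ₑ := continuous_prH.measurable.enorm
  exact hΨ.measurable.ennreal_ofReal.mul (h1.pow_const _)

/-- This holds on the axis too: for `q < n` the real power of `0` is `0`, and so is `ENNReal.toReal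
∞`. -/
theorem toReal_density (hΨ : ∀ X, 0 ≤ Ψ X) (X : E (n + 1)) :
    (density q Ψ X).toReal = Ψ X * ‖prH X‖ ^ (q - n) := by
  rw [density, ENNReal.toReal_mul, ENNReal.toReal_ofReal (hΨ X), ← ENNReal.toReal_rpow,
    toReal_enorm]

theorem exists_density_le (hΨ : Continuous Ψ) {B : Set (E (n + 1))} (hB : IsCompact B) :
    ∃ M : ℝ, 0 ≤ M ∧ (∀ X ∈ B, Ψ X ≤ M) ∧
      ∀ X ∈ B, density q Ψ X ≤ ENNReal.ofReal M * ‖prH X‖ₑ ^ (q - n) := by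
  obtain ⟨M, hM⟩ := hB.exists_bound_of_continuousOn hΨ.continuousOn
  have h : ∀ X ∈ B, Ψ X ≤ max M 0 := fun X hX => ((le_abs_self _).trans (hM X hX)).trans (le_max_left _ _)
  refine ⟨max M 0, le_max_right _ _, h, fun X hX => ?_⟩
  unfold density
  gcongr
  exact h X hX

theorem exists_enorm_prH_rpow_le (hq : n ≤ q) {B : Set (E (n + 1))} (hB : IsCompact B) :
    ∃ M : ℝ≥0, ∀ X ∈ B, ‖prH X‖ₑ ^ (q - n) ≤ M := by
  obtain ⟨M, hM⟩ := hB.exists_bound_of_continuousOn (continuous_prH (n := n)).continuousOn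
  refine ⟨(Real.toNNReal M) ^ (q - n), fun X hX => ?_⟩
  rw [ENNReal.coe_rpow_of_nonneg _ (sub_nonneg.2 hq)]
  refine ENNReal.rpow_le_rpow ?_ (sub_nonneg.2 hq)
  rw [← ofReal_norm]
  exact ENNReal.ofReal_le_ofReal (hM X hX)

theorem lintegral_closedBall_enorm_rpow_lt_top (hq : 0 < q) (hqn : q < n) (ρ : ℝ) :
    ∫⁻ y in Metric.closedBall (0 : E n) ρ, ‖y‖ₑ ^ (q - n) < ∞ := by
  have hn : 1 ≤ n := by
    by_contra h
    have : n = 0 := by omega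
    subst this
    norm_num at hqn
    linarith
  have : Nontrivial (E n) := Module.nontrivial_of_finrank_pos (R := ℝ) (by simpa using Nat.pos_of_ne_zero (by omega))
  have hint : IntegrableOn (fun y : E n => ‖y‖ ^ (q - n)) (Metric.ball 0 (ρ + 1)) volume := by
    refine integrableOn_ball_of_norm_le_rpow (C := 1) (α := n - q) (by simpa using hn)
      (by simpa using hq) (ae_of_all _ fun y => ?_) ?_
    · rw [Real.norm_of_nonneg (by positivity), one_mul, neg_sub]
    · exact (measurable_norm.pow_const _).aestronglyMeasurable
  refine lt_of_le_of_lt ?_ hint.2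
  refine (lintegral_mono_set (Metric.closedBall_subset_ball (by linarith))).trans
    (lintegral_mono_ae ?_)
  refine ae_restrict_of_ae ?_
  -- At `y = 0` the extended power is `∞` but the real power is `0`, so the origin is discarded as a
  -- null set.
  filter_upwards [compl_mem_ae_iff.2 (measure_singleton (0 : E n))] with y hy
  have hy0 : 0 < ‖y‖ := norm_pos_iff.2 hy
  rw [← ofReal_norm, ← ofReal_norm, ENNReal.ofReal_rpow_of_pos hy0,
    Real.norm_of_nonneg (by positivity)]

/-- Splitting off the last coordinate. -/
theorem measurePreserving_last_prH :
    MeasurePreserving (fun X : E (n + 1) => (X (Fin.last n), prH X)) volume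
      ((volume : Measure ℝ).prod (volume : Measure (E n))) := by
  have h1 := PiLp.volume_preserving_ofLp (Fin (n + 1))
  have h2 := volume_preserving_piFinSuccAbove (fun _ : Fin (n + 1) => ℝ) (Fin.last n)
  have h3 := (MeasurePreserving.id (volume : Measure ℝ)).prod (PiLp.volume_preserving_toLp (Fin n))
  have := h3.comp (h2.comp h1)
  convert this using 2 with X
  ext j
  · simp
  · simp [MeasurableEquiv.piFinSuccAbove, prH]
    rfl

theorem lintegral_closedBall_enorm_prH_rpow_lt_top (hq : 0 < q) (hqn : q < n) (c : E (n + 1)) (R : ℝ) :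
    ∫⁻ X in Metric.closedBall c R, ‖prH X‖ₑ ^ (q - n) < ∞ := by
  set ρ := R + ‖c‖
  have hsub : Metric.closedBall c R ⊆ (fun X : E (n + 1) => (X (Fin.last n), prH X)) ⁻¹'
      (Icc (-ρ) ρ ×ˢ Metric.closedBall 0 ρ) := fun X hX => by
    have h1 : ‖X‖ ≤ ρ := by
      have h2 : ‖X - c‖ ≤ R := by simpa [dist_eq_norm] using hX
      have := norm_add_le (X - c) c
      rw [sub_add_cancel] at this
      linarith
    have h3 := norm_sq_eq_add_norm_prH_sq X
    have h0 : 0 ≤ ρ := (norm_nonneg _).trans h1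
    refine ⟨abs_le.1 (abs_le_of_sq_le_sq ?_ h0), ?_⟩
    · dsimp only
      nlinarith [sq_nonneg ‖prH X‖, norm_nonneg X]
    · rw [mem_closedBall_zero_iff]
      refine (abs_le_of_sq_le_sq' ?_ h0).2
      nlinarith [sq_nonneg (X (Fin.last n)), norm_nonneg X]
  have hm : Measurable fun y : E n => ‖y‖ₑ ^ (q - n) := measurable_enorm.pow_const _
  have hS : MeasurableSet (Icc (-ρ) ρ ×ˢ Metric.closedBall (0 : E n) ρ) :=
    measurableSet_Icc.prod Metric.isClosed_closedBall.measurableSet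
  refine (lintegral_mono_set hsub).trans_lt ?_
  rw [measurePreserving_last_prH.setLIntegral_comp_preimage hS (f := fun p => ‖p.2‖ₑ ^ (q - n))
    (hm.comp measurable_snd), ← Measure.prod_restrict,
    lintegral_prod (fun p : ℝ × E n => ‖p.2‖ₑ ^ (q - n)) (hm.comp measurable_snd).aemeasurable]
  simp only [lintegral_const]
  exact ENNReal.mul_lt_top (lintegral_closedBall_enorm_rpow_lt_top hq hqn ρ) (by simp)

theorem lintegral_closedBall_density_lt_top (hq : 0 < q) (hΨ : Continuous Ψ) (c : E (n + 1)) (R : ℝ) :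
    ∫⁻ X in Metric.closedBall c R, density q Ψ X < ∞ := by
  obtain ⟨M, -, -, hM⟩ := exists_density_le (q := q) hΨ (isCompact_closedBall c R)
  have hB := (Metric.isClosed_closedBall (x := c) (ε := R)).measurableSet
  refine (setLIntegral_mono' hB hM).trans_lt ?_
  rw [lintegral_const_mul' _ _ ENNReal.ofReal_ne_top]
  refine ENNReal.mul_lt_top ENNReal.ofReal_lt_top ?_
  rcases lt_or_ge q n with hqn | hqn
  · exact lintegral_closedBall_enorm_prH_rpow_lt_top hq hqn c R
  · obtain ⟨M', hM'⟩ := exists_enorm_prH_rpow_le hqn (isCompact_closedBall c R)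
    refine (setLIntegral_mono' hB hM').trans_lt ?_
    rw [setLIntegral_const]
    exact ENNReal.mul_lt_top ENNReal.coe_lt_top measure_closedBall_lt_top

theorem weightedMeasure_lt_top (hq : 0 < q) (hΨ : Continuous Ψ) (K : ConvexBody (E (n + 1))) :
    weightedMeasure q Ψ (K : Set (E (n + 1))) < ∞ := by
  obtain ⟨R, hR⟩ := K.isBounded.subset_closedBall 0
  rw [weightedMeasure, withDensity_apply _ K.isClosed.measurableSet]
  exact (lintegral_mono_set hR).trans_lt (lintegral_closedBall_density_lt_top hq hΨ _ _)

variable {K : ConvexBody (E (n + 1))} {Km : ℕ → ConvexBody (E (n + 1))}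

/-- An interior point of `K` carries a ball half of which survives in `Km m`; an exterior point has
positive distance from `K`. -/
theorem eventually_mem_iff (hKm : Tendsto Km atTop (𝓝 K)) {X : E (n + 1)}
    (hX : X ∉ frontier (K : Set (E (n + 1)))) : ∀ᶠ m in atTop, (X ∈ Km m ↔ X ∈ K) := by
  by_cases hXK : X ∈ K
  · have hint : X ∈ interior (K : Set (E (n + 1))) := by
      rw [K.isClosed.frontier_eq] at hX
      by_contra h
      exact hX ⟨hXK, h⟩
    obtain ⟨r, hr, h⟩ := Metric.isOpen_iff.1 isOpen_interior X hint
    obtain ⟨R, h'⟩ := K.isBounded.subset_closedBall X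
    filter_upwards [eventually_uniform_bounds hKm hr (h.trans interior_subset) h'] with m hm
    exact iff_of_true (hm.1 (Metric.mem_ball_self (half_pos hr))) hXK
  · have hpos : 0 < dist X (proj K X) := dist_pos.2 fun h => hXK (by rw [h]; exact proj_mem K X)
    filter_upwards [(tendsto_iff_dist_tendsto_zero.1 hKm).eventually (gt_mem_nhds hpos)] with m hm
    refine iff_of_false (fun h => ?_) hXK
    have := dist_proj_le_dist K (Km m) h
    rw [dist_comm K] at this
    linarith

theorem tendsto_weightedMeasure (hq : 0 < q) (hΨ : Continuous Ψ) (hKm : Tendsto Km atTop (𝓝 K)) :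
    Tendsto (fun m => weightedMeasure q Ψ (Km m : Set (E (n + 1)))) atTop
      (𝓝 (weightedMeasure q Ψ (K : Set (E (n + 1))))) := by
  obtain ⟨R, hR⟩ := K.isBounded.subset_closedBall 0
  have hw : ∀ L : ConvexBody (E (n + 1)), weightedMeasure q Ψ (L : Set (E (n + 1))) =
      ∫⁻ X, (L : Set (E (n + 1))).indicator (density q Ψ) X := fun L => by
    rw [weightedMeasure, withDensity_apply _ L.isClosed.measurableSet,
      lintegral_indicator L.isClosed.measurableSet]
  simp only [hw]
  refine tendsto_lintegral_filter_of_dominated_convergence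
    ((Metric.closedBall 0 (R + 1)).indicator (density q Ψ)) ?_ ?_ ?_ ?_
  · exact Eventually.of_forall fun m => (measurable_density hΨ).indicator (Km m).isClosed.measurableSet
  · filter_upwards [(tendsto_iff_dist_tendsto_zero.1 hKm).eventually (ge_mem_nhds one_pos)] with m hm
    exact ae_of_all _ fun X => indicator_le_indicator_of_subset
      (subset_closedBall_of_dist_le hR hm) (fun _ => zero_le) X
  · rw [lintegral_indicator Metric.isClosed_closedBall.measurableSet]
    exact (lintegral_closedBall_density_lt_top hq hΨ _ _).ne
  · filter_upwards [measure_eq_zero_iff_ae_notMem.1 (K.convex.addHaar_frontier volume)] with X hX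
    refine tendsto_const_nhds.congr' ?_
    filter_upwards [eventually_mem_iff hKm hX] with m hm
    by_cases h : X ∈ K
    · rw [indicator_of_mem (show X ∈ (K : Set (E (n + 1))) from h), indicator_of_mem (hm.2 h)]
    · rw [indicator_of_notMem (show X ∉ (K : Set (E (n + 1))) from h),
        indicator_of_notMem (fun h' => h (hm.1 h'))]

end Density

theorem ennreal_rpow_le_rpow_of_nonpos {a b : ℝ≥0∞} {p : ℝ} (hp : p ≤ 0) (hab : a ≤ b) :
    b ^ p ≤ a ^ p := by
  rw [← neg_neg p, ENNReal.rpow_neg b, ENNReal.rpow_neg a, ENNReal.inv_le_inv]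
  exact ENNReal.rpow_le_rpow hab (neg_nonneg.2 hp)

/-! ### Uniform estimates for the boundary near the axis -/

section Axis

variable {n : ℕ} {q : ℝ} {K : ConvexBody (E (n + 1))} {c : E (n + 1)} {r R δ : ℝ}

/-- Boundary points are at distance at least `r` from `c`. One within `r / 2` of the axis therefore
has height at least `r / 2` relative to `c`, and division by that height gives a parameter of norm
at most `2 δ / r`. -/
theorem frontier_near_axis_subset (hr : 0 < r) (h : Metric.ball c r ⊆ (K : Set (E (n + 1))))
    (hc : prH c = 0) (hδ : δ ≤ r / 2) :
    {X | ‖prH X‖ < δ} ∩ frontier (K : Set (E (n + 1))) ⊆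
      chart K c (Fin.last n) 1 '' Metric.closedBall 0 (2 * δ / r) ∪
        chart K c (Fin.last n) (-1) '' Metric.closedBall 0 (2 * δ / r) := by
  rintro X ⟨hXδ, hX⟩
  replace hXδ : ‖prH X‖ < δ := hXδ
  have hg : gaugeAt K c (X - c) = 1 := (mem_frontier_iff_gaugeAt hr h).1 (by simpa using hX)
  have hnorm : r ≤ ‖X - c‖ := by
    have := gaugeAt_mul_le h (X - c)
    rwa [hg, mul_one] at this
  have hpr : prH (X - c) = prH X := by
    have := prH_add (X - c) c
    rwa [hc, add_zero, sub_add_cancel, eq_comm] at this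
  have hsq := norm_sq_eq_add_norm_prH_sq (X - c)
  rw [hpr] at hsq
  set a := (X - c) (Fin.last n) with ha
  have hδ0 : 0 < δ := (norm_nonneg _).trans_lt hXδ
  have ha2 : r / 2 ≤ |a| := by
    refine le_of_sq_le_sq ?_ (abs_nonneg a)
    rw [sq_abs]
    nlinarith [norm_nonneg (prH X), norm_nonneg (X - c)]
  have ha0 : 0 < |a| := by linarith
  have hchart := chart_removeCoord hr h hX (abs_pos.1 ha0)
  rw [← ha, ← prH_eq_removeCoord, hpr] at hchart
  have hmem : |a|⁻¹ • prH X ∈ Metric.closedBall (0 : E n) (2 * δ / r) := by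
    rw [mem_closedBall_zero_iff, norm_smul, norm_inv, Real.norm_eq_abs, abs_abs,
      inv_mul_le_iff₀ ha0]
    calc ‖prH X‖ ≤ δ := hXδ.le
      _ = r / 2 * (2 * δ / r) := by field_simp
      _ ≤ |a| * (2 * δ / r) := by gcongr
  rcases lt_or_gt_of_ne (abs_pos.1 ha0) with h1 | h1
  · right
    exact ⟨_, hmem, by rw [abs_of_neg h1, div_neg, div_self h1.ne] at hchart; rwa [abs_of_neg h1]⟩
  · left
    exact ⟨_, hmem, by rw [abs_of_pos h1, div_self h1.ne'] at hchart; rwa [abs_of_pos h1]⟩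

/-- The horizontal part of the chart is `y` divided by the gauge, and the gauge is at most `2 / r`;
the negative exponent reverses the inequality. -/
theorem enorm_prH_chart_rpow_le (hq : q < n) (hr : 0 < r)
    (h : Metric.ball c r ⊆ (K : Set (E (n + 1)))) (hc : prH c = 0) {s : ℝ} (hs : s ^ 2 = 1) {y : E n}
    (hy : ‖y‖ ≤ 1) :
    ‖prH (chart K c (Fin.last n) s y)‖ₑ ^ (q - n) ≤
      ENNReal.ofReal (r / 2) ^ (q - n) * ‖y‖ₑ ^ (q - n) := by
  have hs0 : s ≠ 0 := by rintro rfl; norm_num at hs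
  set g := gaugeAt K c (insertCoord (Fin.last n) s y) with hgdef
  have hg : 0 < g := gaugeAt_pos hr h (insertCoord_ne_zero hs0 y)
  have hg2 : r / 2 ≤ g⁻¹ := by
    have h1 := gaugeAt_mul_le h (insertCoord (Fin.last n) s y)
    have h2 := norm_insertCoord_le (i := Fin.last n) hs y
    rw [← hgdef] at h1
    rw [le_inv_comm₀ (by positivity) hg, inv_div, le_div_iff₀ hr]
    linarith
  rw [chart, prH_add, hc, zero_add, prH_smul, prH_insertCoord_last, ← hgdef,
    ← ENNReal.mul_rpow_of_ne_top ENNReal.ofReal_ne_top enorm_ne_top]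
  refine ennreal_rpow_le_rpow_of_nonpos (by linarith) ?_
  rw [enorm_smul, Real.enorm_of_nonneg (inv_pos.2 hg).le]
  gcongr

/-- The constant in `lintegral_boundaryMeasure_near_axis_le`. -/
def axisConst (n : ℕ) (q r R : ℝ) : ℝ≥0∞ :=
  2 * (((R + (1 + 1) * R ^ 2 / r).toNNReal : ℝ≥0∞) ^ n * ENNReal.ofReal (r / 2) ^ (q - n))

theorem axisConst_ne_top (hr : 0 < r) : axisConst n q r R ≠ ∞ :=
  ENNReal.mul_ne_top (by simp) (ENNReal.mul_ne_top (by simp)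
    (ENNReal.rpow_ne_top_of_ne_zero (by simpa using hr) (by simp)))

/-- Both caps are transferred to `ℝⁿ` by their charts. The bound involves `K` only through `r` and
`R`, so it applies to all late bodies at once. -/
theorem lintegral_boundaryMeasure_near_axis_le (hq : q < n) (hr : 0 < r) (hR : 0 < R)
    (h : Metric.ball c r ⊆ (K : Set (E (n + 1))))
    (h' : (K : Set (E (n + 1))) ⊆ Metric.closedBall c R) (hc : prH c = 0) (hδ : δ ≤ r / 2) :
    ∫⁻ X in {X | ‖prH X‖ < δ}, ‖prH X‖ₑ ^ (q - n) ∂boundaryMeasure K ≤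
      axisConst n q r R * ∫⁻ y in Metric.closedBall (0 : E n) (2 * δ / r), ‖y‖ₑ ^ (q - n) := by
  have hρ : 2 * δ / r ≤ 1 := by rw [div_le_one hr]; linarith
  have hone : ∀ s : ℝ, s ^ 2 = 1 →
      ∫⁻ X in chart K c (Fin.last n) s '' Metric.closedBall 0 (2 * δ / r), ‖prH X‖ₑ ^ (q - n)
        ∂(μHE[n] : Measure (E (n + 1))) ≤
      ((R + (1 + 1) * R ^ 2 / r).toNNReal : ℝ≥0∞) ^ n * (ENNReal.ofReal (r / 2) ^ (q - n) *
        ∫⁻ y in Metric.closedBall (0 : E n) (2 * δ / r), ‖y‖ₑ ^ (q - n)) := fun s hs => by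
    refine (setLIntegral_image_le Metric.isClosed_closedBall.measurableSet
      ((lipschitzOnWith_chart hr hR one_pos h h' hs).mono
        (Metric.closedBall_subset_closedBall hρ)) _).trans ?_
    rw [EuclideanSpace.euclideanHausdorffMeasure_eq_volume]
    gcongr
    rw [← lintegral_const_mul _ (measurable_enorm.pow_const _)]
    refine setLIntegral_mono' Metric.isClosed_closedBall.measurableSet fun y hy => ?_
    exact enorm_prH_chart_rpow_le hq hr h hc hs ((mem_closedBall_zero_iff.1 hy).trans hρ)
  rw [boundaryMeasure, Measure.restrict_restrict' isClosed_frontier.measurableSet]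
  refine (lintegral_mono_set (frontier_near_axis_subset hr h hc hδ)).trans ?_
  refine (lintegral_union_le _ _ _).trans ((add_le_add (hone 1 (by norm_num))
    (hone (-1) (by norm_num))).trans (le_of_eq ?_))
  rw [axisConst]
  ring

theorem tendsto_lintegral_closedBall_enorm_rpow (hq : 0 < q) (hqn : q < n) (hr : 0 < r) :
    Tendsto (fun δ : ℝ => ∫⁻ y in Metric.closedBall (0 : E n) (2 * δ / r), ‖y‖ₑ ^ (q - n)) (𝓝[>] 0)
      (𝓝 0) := by
  -- In dimension zero the balls would not shrink in volume; `0 < q < n` excludes this.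
  have hn : n ≠ 0 := by rintro rfl; norm_num at hqn; linarith
  have : Nonempty (Fin n) := ⟨⟨0, Nat.pos_of_ne_zero hn⟩⟩
  have hmem : ∀ᶠ δ : ℝ in 𝓝[>] 0, δ < r / 2 := nhdsWithin_le_nhds (gt_mem_nhds (half_pos hr))
  have hvol : Tendsto (fun δ : ℝ => (volume.restrict (Metric.closedBall (0 : E n) 1))
      (Metric.closedBall (0 : E n) (2 * δ / r))) (𝓝[>] 0) (𝓝 0) := by
    refine tendsto_of_tendsto_of_tendsto_of_le_of_le (g := 0) tendsto_const_nhds (h := fun δ : ℝ =>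
      volume (Metric.closedBall (0 : E n) (2 * δ / r))) ?_ (fun _ => zero_le)
      (fun δ => Measure.restrict_apply_le _ _)
    simp only [EuclideanSpace.volume_closedBall]
    have h1 : Tendsto (fun δ : ℝ => ENNReal.ofReal (2 * δ / r) ^ n) (𝓝[>] 0) (𝓝 0) := by
      have hc : Continuous fun δ : ℝ => ENNReal.ofReal (2 * δ / r) ^ n := by
        refine (ENNReal.continuous_pow n).comp (ENNReal.continuous_ofReal.comp ?_)
        fun_prop
      simpa [hn] using (hc.tendsto 0).mono_left nhdsWithin_le_nhds
    simpa using ENNReal.Tendsto.mul_const h1 (Or.inr ENNReal.ofReal_ne_top)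
  refine (tendsto_setLIntegral_zero
    (lintegral_closedBall_enorm_rpow_lt_top hq hqn 1).ne hvol).congr' ?_
  filter_upwards [hmem] with δ hδ
  rw [Measure.restrict_restrict_of_subset]
  exact Metric.closedBall_subset_closedBall (by rw [div_le_one hr]; linarith)

end Axis

/-! ### Finiteness and convergence of the weighted surface integrals -/

section SurfaceIntegral

variable {n : ℕ} {q : ℝ} {Ψ : E (n + 1) → ℝ} {K : ConvexBody (E (n + 1))}
  {Km : ℕ → ConvexBody (E (n + 1))} {c : E (n + 1)} {r R δ : ℝ}

theorem lintegral_boundaryMeasure_density_lt_top_of_le (hq : n ≤ q) (hΨ : Continuous Ψ)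
    (hK : (interior (K : Set (E (n + 1)))).Nonempty) :
    ∫⁻ X, density q Ψ X ∂boundaryMeasure K < ∞ := by
  have := isFiniteMeasure_boundaryMeasure hK
  obtain ⟨M, -, -, hM⟩ := exists_density_le (q := q) hΨ K.isCompact
  obtain ⟨M', hM'⟩ := exists_enorm_prH_rpow_le hq K.isCompact
  have hle : ∀ᵐ X ∂boundaryMeasure K, density q Ψ X ≤ ENNReal.ofReal M * M' := by
    filter_upwards [ae_boundaryMeasure_mem] with X hX
    have hXK := K.isClosed.frontier_subset hX
    exact (hM X hXK).trans (by gcongr; exact hM' X hXK)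
  refine (lintegral_mono_ae hle).trans_lt ?_
  rw [lintegral_const]
  exact ENNReal.mul_lt_top (ENNReal.mul_lt_top ENNReal.ofReal_lt_top ENNReal.coe_lt_top)
    (measure_lt_top _ _)

/-- Split the boundary at distance `r / 2` from the axis: the chart estimate handles the near part,
and on the rest the power is bounded. -/
theorem lintegral_boundaryMeasure_density_lt_top (hq : 0 < q) (hqn : q < n) (hΨ : Continuous Ψ)
    (hr : 0 < r) (h : Metric.ball c r ⊆ (K : Set (E (n + 1)))) (hc : prH c = 0) :
    ∫⁻ X, density q Ψ X ∂boundaryMeasure K < ∞ := by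
  have := isFiniteMeasure_boundaryMeasure (interior_nonempty_of_ball_subset hr h)
  obtain ⟨R, hR, h'⟩ := K.isBounded.subset_closedBall_lt 0 c
  obtain ⟨M, -, -, hM⟩ := exists_density_le (q := q) hΨ K.isCompact
  have hle : ∀ᵐ X ∂boundaryMeasure K,
      density q Ψ X ≤ ENNReal.ofReal M * ‖prH X‖ₑ ^ (q - n) := by
    filter_upwards [ae_boundaryMeasure_mem] with X hX
    exact hM X (K.isClosed.frontier_subset hX)
  refine (lintegral_mono_ae hle).trans_lt ?_
  rw [lintegral_const_mul' _ _ ENNReal.ofReal_ne_top]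
  refine ENNReal.mul_lt_top ENNReal.ofReal_lt_top ?_
  have hms : MeasurableSet {X : E (n + 1) | ‖prH X‖ < r / 2} :=
    (isOpen_lt continuous_prH.norm continuous_const).measurableSet
  rw [← lintegral_add_compl _ hms]
  refine ENNReal.add_lt_top.2 ⟨?_, ?_⟩
  · refine (lintegral_boundaryMeasure_near_axis_le hqn hr hR h h' hc le_rfl).trans_lt ?_
    exact ENNReal.mul_lt_top (axisConst_ne_top hr).lt_top
      (lintegral_closedBall_enorm_rpow_lt_top hq hqn _)
  · refine (setLIntegral_mono' (g := fun _ => ENNReal.ofReal (r / 2) ^ (q - n)) hms.compl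
      fun X hX => ?_).trans_lt ?_
    · refine ennreal_rpow_le_rpow_of_nonpos (by linarith) ?_
      rw [← ofReal_norm]
      exact ENNReal.ofReal_le_ofReal (not_lt.1 hX)
    · rw [setLIntegral_const]
      exact ENNReal.mul_lt_top (ENNReal.rpow_ne_top_of_ne_zero (by simpa using hr) (by simp)).lt_top
        (measure_lt_top _ _)

theorem isFiniteMeasure_weightedSurfaceAreaMeasure (hK : (interior (K : Set (E (n + 1)))).Nonempty)
    {w : E (n + 1) → ℝ≥0∞} (hw : ∫⁻ X, w X ∂boundaryMeasure K < ∞) :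
    IsFiniteMeasure (weightedSurfaceAreaMeasure w K) := by
  rw [weightedSurfaceAreaMeasure_eq_map hK]
  have := isFiniteMeasure_withDensity hw.ne
  infer_instance

theorem integral_weightedSurfaceAreaMeasure (hΨ : Continuous Ψ) (hΨ0 : ∀ X, 0 ≤ Ψ X)
    (hK : (interior (K : Set (E (n + 1)))).Nonempty)
    (hw : ∫⁻ X, density q Ψ X ∂boundaryMeasure K < ∞) (f : C(S (n + 1), ℝ)) :
    ∫ ν, f ν ∂weightedSurfaceAreaMeasure (density q Ψ) K =
      ∫ X, Ψ X * ‖prH X‖ ^ (q - n) * f (normal K X) ∂boundaryMeasure K := by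
  rw [weightedSurfaceAreaMeasure_eq_map hK, integral_map
    ((aemeasurable_normal hK).mono_ac (withDensity_absolutelyContinuous _ _))
    f.continuous.aestronglyMeasurable,
    integral_withDensity_eq_integral_toReal_smul (measurable_density hΨ)
      (ae_lt_top (measurable_density hΨ) hw.ne)]
  simp only [toReal_density hΨ0, smul_eq_mul]

/-- The density with the factor `|x|^(q - n)` truncated near the axis. -/
def truncatedDensity (q : ℝ) (Ψ : E (n + 1) → ℝ) (δ : ℝ) (X : E (n + 1)) : ℝ :=
  Ψ X * (max ‖prH X‖ δ) ^ (q - n)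

theorem continuous_truncatedDensity (hΨ : Continuous Ψ) (hδ : 0 < δ) :
    Continuous (truncatedDensity q Ψ δ) := by
  refine hΨ.mul (Continuous.rpow_const (continuous_prH.norm.max continuous_const) fun X => Or.inl ?_)
  exact (hδ.trans_le (le_max_right _ _)).ne'

theorem enorm_sub_truncated_rpow_le {p t : ℝ} (hp : p < 0) (ht : 0 ≤ t) (htδ : t < δ) :
    ‖t ^ p - (max t δ) ^ p‖ₑ ≤ ‖t‖ₑ ^ p := by
  rw [max_eq_right htδ.le]
  -- At `t = 0` the right-hand side is `∞`, whatever value the real power takes.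
  rcases ht.eq_or_lt with rfl | ht
  · simp [ENNReal.zero_rpow_of_neg hp]
  · have h1 : δ ^ p ≤ t ^ p := Real.rpow_le_rpow_of_nonpos ht htδ.le hp.le
    rw [Real.enorm_of_nonneg (sub_nonneg.2 h1), Real.enorm_of_nonneg ht.le,
      ENNReal.ofReal_rpow_of_pos ht]
    exact ENNReal.ofReal_le_ofReal (by linarith [Real.rpow_nonneg (ht.trans htδ).le p])

/-- The integrands differ only within `δ` of the axis, where truncation changes the power by at most
the power itself. -/
theorem enorm_integral_sub_truncated_le (hqn : q < n) (hΨ : Continuous Ψ) (hΨ0 : ∀ X, 0 ≤ Ψ X)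
    (hr : 0 < r) (hR : 0 < R) (h : Metric.ball c r ⊆ (K : Set (E (n + 1))))
    (h' : (K : Set (E (n + 1))) ⊆ Metric.closedBall c R) (hc : prH c = 0) (hδ0 : 0 < δ)
    (hδ : δ ≤ r / 2) (hw : ∫⁻ X, density q Ψ X ∂boundaryMeasure K < ∞)
    {M : ℝ} (hM : ∀ X ∈ K, Ψ X ≤ M) (f : C(S (n + 1), ℝ)) :
    ‖∫ X, Ψ X * ‖prH X‖ ^ (q - n) * f (normal K X) ∂boundaryMeasure K -
      ∫ X, truncatedDensity q Ψ δ X * f (normal K X) ∂boundaryMeasure K‖ₑ ≤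
    ENNReal.ofReal M * ‖f‖ₑ * (axisConst n q r R *
      ∫⁻ y in Metric.closedBall (0 : E n) (2 * δ / r), ‖y‖ₑ ^ (q - n)) := by
  have hK := interior_nonempty_of_ball_subset hr h
  have := isFiniteMeasure_boundaryMeasure hK
  have hfm : AEMeasurable (fun X => f (normal K X)) (boundaryMeasure K) :=
    f.continuous.measurable.comp_aemeasurable (aemeasurable_normal hK)
  have hi1 : Integrable (fun X => Ψ X * ‖prH X‖ ^ (q - n) * f (normal K X)) (boundaryMeasure K) := by
    refine Integrable.mul_bdd (c := ‖f‖) ?_ hfm.aestronglyMeasurable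
      (ae_of_all _ fun X => f.norm_coe_le_norm _)
    simpa only [toReal_density hΨ0] using
      integrable_toReal_of_lintegral_ne_top (measurable_density hΨ).aemeasurable hw.ne
  have hi2 : Integrable (fun X => truncatedDensity q Ψ δ X * f (normal K X)) (boundaryMeasure K) := by
    refine Integrable.mul_bdd (c := ‖f‖) ?_ hfm.aestronglyMeasurable
      (ae_of_all _ fun X => f.norm_coe_le_norm _)
    have hcont := continuous_truncatedDensity (q := q) hΨ hδ0
    obtain ⟨B, hB⟩ := K.isCompact.exists_bound_of_continuousOn hcont.continuousOn
    refine Integrable.of_bound hcont.aestronglyMeasurable B ?_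
    filter_upwards [ae_boundaryMeasure_mem] with X hX
    exact hB X (K.isClosed.frontier_subset hX)
  rw [← integral_sub hi1 hi2]
  refine (enorm_integral_le_lintegral_enorm _).trans ?_
  have hms : MeasurableSet {X : E (n + 1) | ‖prH X‖ < δ} :=
    (isOpen_lt continuous_prH.norm continuous_const).measurableSet
  calc _ ≤ ∫⁻ X, {X : E (n + 1) | ‖prH X‖ < δ}.indicator
        (fun X => ENNReal.ofReal M * ‖f‖ₑ * ‖prH X‖ₑ ^ (q - n)) X ∂boundaryMeasure K := by
        refine lintegral_mono_ae ?_
        filter_upwards [ae_boundaryMeasure_mem] with X hX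
        rw [truncatedDensity, ← sub_mul, ← mul_sub, enorm_mul, enorm_mul]
        by_cases hXδ : ‖prH X‖ < δ
        · rw [indicator_of_mem (show X ∈ {X : E (n + 1) | ‖prH X‖ < δ} from hXδ)]
          have h1 : ‖Ψ X‖ₑ ≤ ENNReal.ofReal M := by
            rw [Real.enorm_of_nonneg (hΨ0 X)]
            exact ENNReal.ofReal_le_ofReal (hM X (K.isClosed.frontier_subset hX))
          have h2 : ‖f (normal K X)‖ₑ ≤ ‖f‖ₑ := by
            rw [← ofReal_norm, ← ofReal_norm]
            exact ENNReal.ofReal_le_ofReal (f.norm_coe_le_norm _)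
          have h3 := enorm_sub_truncated_rpow_le (p := q - n) (by linarith) (norm_nonneg _) hXδ
          rw [enorm_norm] at h3
          calc _ ≤ ENNReal.ofReal M * ‖prH X‖ₑ ^ (q - n) * ‖f‖ₑ := by gcongr
            _ = _ := by ring
        · rw [max_eq_left (not_lt.1 hXδ)]
          simp
    _ ≤ _ := by
        rw [lintegral_indicator hms, lintegral_const_mul' _ _
          (ENNReal.mul_ne_top ENNReal.ofReal_ne_top enorm_ne_top)]
        gcongr
        exact lintegral_boundaryMeasure_near_axis_le hqn hr hR h h' hc hδ

theorem tendsto_of_forall_approx {a : ℕ → ℝ} {a₀ : ℝ}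
    (h : ∀ ε > 0, ∃ (b : ℕ → ℝ) (b₀ : ℝ), Tendsto b atTop (𝓝 b₀) ∧ (∀ᶠ m in atTop, ‖a m - b m‖ ≤ ε) ∧
      ‖a₀ - b₀‖ ≤ ε) : Tendsto a atTop (𝓝 a₀) := by
  refine Metric.tendsto_nhds.2 fun ε hε => ?_
  obtain ⟨b, b₀, hb, h1, h2⟩ := h (ε / 4) (by positivity)
  filter_upwards [h1, Metric.tendsto_nhds.1 hb (ε / 4) (by positivity)] with m hm1 hm2
  rw [← dist_eq_norm] at hm1 h2
  have h3 := dist_triangle4 (a m) (b m) b₀ a₀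
  rw [dist_comm b₀] at h3
  linarith

/-- For fixed `δ` the truncated integrand is continuous and its integrals converge. The truncation
error tends to `0` with `δ`, uniformly over all bodies between the balls of radii `r / 2` and `R +
1` about `c`. -/
theorem tendsto_integral_boundaryMeasure_density (hq : 0 < q) (hqn : q < n) (hΨ : Continuous Ψ)
    (hΨ0 : ∀ X, 0 ≤ Ψ X) (hr : 0 < r) (h : Metric.ball c r ⊆ (K : Set (E (n + 1)))) (hc : prH c = 0)
    (hKm : Tendsto Km atTop (𝓝 K)) (f : C(S (n + 1), ℝ)) :
    Tendsto (fun m => ∫ X, Ψ X * ‖prH X‖ ^ (q - n) * f (normal (Km m) X) ∂boundaryMeasure (Km m))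
      atTop (𝓝 (∫ X, Ψ X * ‖prH X‖ ^ (q - n) * f (normal K X) ∂boundaryMeasure K)) := by
  obtain ⟨R, hR, h'⟩ := K.isBounded.subset_closedBall_lt 0 c
  obtain ⟨M, hM0, hM, -⟩ := exists_density_le (q := q) hΨ (isCompact_closedBall c (R + 1))
  have hr2 := half_pos hr
  have hlim := ENNReal.Tendsto.const_mul (a := ENNReal.ofReal M * ‖f‖ₑ)
    (ENNReal.Tendsto.const_mul (tendsto_lintegral_closedBall_enorm_rpow hq hqn hr2)
      (Or.inr (axisConst_ne_top (n := n) (q := q) (R := R + 1) hr2)))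
      (Or.inr (ENNReal.mul_ne_top ENNReal.ofReal_ne_top enorm_ne_top))
  simp only [mul_zero] at hlim
  refine tendsto_of_forall_approx fun ε hε => ?_
  have hsmall : ∀ᶠ δ : ℝ in 𝓝[>] 0, δ ≤ r / 2 / 2 := nhdsWithin_le_nhds (ge_mem_nhds (half_pos hr2))
  obtain ⟨δ, hδε, hδ, hδ0⟩ := ((hlim.eventually (ge_mem_nhds (ENNReal.ofReal_pos.2 hε))).and
    (hsmall.and self_mem_nhdsWithin)).exists
  have key : ∀ L : ConvexBody (E (n + 1)), Metric.ball c (r / 2) ⊆ (L : Set (E (n + 1))) →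
      (L : Set (E (n + 1))) ⊆ Metric.closedBall c (R + 1) →
      ‖∫ X, Ψ X * ‖prH X‖ ^ (q - n) * f (normal L X) ∂boundaryMeasure L -
        ∫ X, truncatedDensity q Ψ δ X * f (normal L X) ∂boundaryMeasure L‖ ≤ ε := fun L hL hL' => by
    have := (enorm_integral_sub_truncated_le hqn hΨ hΨ0 hr2 (by positivity) hL hL' hc hδ0 hδ
      (lintegral_boundaryMeasure_density_lt_top hq hqn hΨ hr2 hL hc)
      (fun X hX => hM X (hL' hX)) f).trans hδε
    rwa [← ofReal_norm, ENNReal.ofReal_le_ofReal_iff hε.le] at this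
  refine ⟨_, _, tendsto_integral_boundaryMeasure (interior_nonempty_of_ball_subset hr h) hKm
    (g := fun p => truncatedDensity q Ψ δ p.1 * f p.2) ?_, ?_, ?_⟩
  · exact ((continuous_truncatedDensity hΨ hδ0).comp continuous_fst).mul
      (f.continuous.comp continuous_snd)
  · filter_upwards [eventually_uniform_bounds hKm hr h h'] with m hm
    exact key _ hm.1 hm.2
  · exact key K ((Metric.ball_subset_ball (by linarith)).trans h)
      (h'.trans (Metric.closedBall_subset_closedBall (by linarith)))

end SurfaceIntegral

end WeightedBM

end

/-! ### The theorem -/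

theorem lemma3p6 (n : ℕ) (q : ℝ) (hq : 0 < q)
    (Ψ : WeightedBM.E (n + 1) → ℝ) (hΨ : Continuous Ψ) (hΨ_nonneg : ∀ X, 0 ≤ Ψ X)
    (Km : ℕ → ConvexBody (WeightedBM.E (n + 1))) (K : ConvexBody (WeightedBM.E (n + 1)))
    (hK : (interior (K : Set (WeightedBM.E (n + 1)))).Nonempty)
    (hKm : Tendsto Km atTop (𝓝 K))
    (ho : q < n → (0 : WeightedBM.E n) ∈ WeightedBM.prH ''
      (interior (K : Set (WeightedBM.E (n + 1))) ∩
        ⋂ m, interior (Km m : Set (WeightedBM.E (n + 1))))) :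
    (WeightedBM.weightedMeasure q Ψ (K : Set (WeightedBM.E (n + 1))) < ∞ ∧
      Tendsto (fun m => WeightedBM.weightedMeasure q Ψ (Km m : Set (WeightedBM.E (n + 1)))) atTop
        (𝓝 (WeightedBM.weightedMeasure q Ψ (K : Set (WeightedBM.E (n + 1)))))) ∧
    (IsFiniteMeasure (WeightedBM.weightedSurfaceAreaMeasure (WeightedBM.density q Ψ) K) ∧
      (∀ᶠ m in atTop,
        IsFiniteMeasure (WeightedBM.weightedSurfaceAreaMeasure (WeightedBM.density q Ψ) (Km m))) ∧
      ∀ f : C(WeightedBM.S (n + 1), ℝ),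
        Tendsto
          (fun m => ∫ ν, f ν ∂(WeightedBM.weightedSurfaceAreaMeasure (WeightedBM.density q Ψ) (Km m)))
          atTop
          (𝓝 (∫ ν, f ν ∂(WeightedBM.weightedSurfaceAreaMeasure (WeightedBM.density q Ψ) K)))) := by
  open WeightedBM in
  refine ⟨⟨weightedMeasure_lt_top hq hΨ K, tendsto_weightedMeasure hq hΨ hKm⟩, ?_⟩
  -- One centre serves for `K` and for all late `Km m`; in the singular case it lies on the axis, as
  -- the chart estimates require.
  obtain ⟨c, hc, hc0⟩ : ∃ c ∈ interior (K : Set (E (n + 1))), q < n → prH c = 0 := by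
    rcases lt_or_ge q n with hqn | hqn
    · obtain ⟨c, hc, hc0⟩ := ho hqn
      exact ⟨c, hc.1, fun _ => hc0⟩
    · exact ⟨hK.some, hK.some_mem, fun h => absurd h hqn.not_gt⟩
  obtain ⟨r, hr, h⟩ := Metric.isOpen_iff.1 isOpen_interior c hc
  replace h := h.trans interior_subset
  obtain ⟨R, h'⟩ := K.isBounded.subset_closedBall c
  have hfin : ∀ L : ConvexBody (E (n + 1)), ∀ ρ > 0, Metric.ball c ρ ⊆ (L : Set (E (n + 1))) →
      ∫⁻ X, density q Ψ X ∂boundaryMeasure L < ∞ := fun L ρ hρ hL => by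
    rcases lt_or_ge q n with hqn | hqn
    · exact lintegral_boundaryMeasure_density_lt_top hq hqn hΨ hρ hL (hc0 hqn)
    · exact lintegral_boundaryMeasure_density_lt_top_of_le hqn hΨ
        (interior_nonempty_of_ball_subset hρ hL)
  have hball : ∀ᶠ m in atTop, Metric.ball c (r / 2) ⊆ (Km m : Set (E (n + 1))) :=
    (eventually_uniform_bounds hKm hr h h').mono fun m hm => hm.1
  refine ⟨isFiniteMeasure_weightedSurfaceAreaMeasure hK (hfin K r hr h), ?_, fun f => ?_⟩
  · filter_upwards [hball] with m hm
    exact isFiniteMeasure_weightedSurfaceAreaMeasure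
      (interior_nonempty_of_ball_subset (half_pos hr) hm) (hfin _ _ (half_pos hr) hm)
  rw [integral_weightedSurfaceAreaMeasure hΨ hΨ_nonneg hK (hfin K r hr h)]
  have hlim : Tendsto (fun m => ∫ X, Ψ X * ‖prH X‖ ^ (q - n) * f (normal (Km m) X)
      ∂boundaryMeasure (Km m)) atTop
      (𝓝 (∫ X, Ψ X * ‖prH X‖ ^ (q - n) * f (normal K X) ∂boundaryMeasure K)) := by
    rcases lt_or_ge q n with hqn | hqn
    · exact tendsto_integral_boundaryMeasure_density hq hqn hΨ hΨ_nonneg hr h (hc0 hqn) hKm f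
    · refine tendsto_integral_boundaryMeasure hK hKm
        (g := fun p => Ψ p.1 * ‖prH p.1‖ ^ (q - n) * f p.2) ?_
      have h1 : Continuous fun X : E (n + 1) => ‖prH X‖ ^ (q - n) :=
        continuous_prH.norm.rpow_const fun X => Or.inr (sub_nonneg.2 hqn)
      exact ((hΨ.mul h1).comp continuous_fst).mul (f.continuous.comp continuous_snd)
  refine hlim.congr' ?_
  filter_upwards [hball] with m hm
  exact (integral_weightedSurfaceAreaMeasure hΨ hΨ_nonneg
    (interior_nonempty_of_ball_subset (half_pos hr) hm) (hfin _ _ (half_pos hr) hm) f).symm
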